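/- **Model.** Let $G=(V,E)$ be a finite graph with $N=|V|\ge 1$ nodes that is $K$-partite, $K\ge 2$, with components $V_1,\dots,V_K$ (no edges inside a component), such that every node belongs to a clique of size $K$. Let $M_k=|V_k|$ and $M=\max_k M_k$. Let $\Omega\subseteq\{0,1\}^V$ be the set of incidence vectors of independent sets of $G$ (feasible activity states), let $v^{(k)}=1_{V_k}$ and $\Omega^*=\{v^{(1)},\dots,v^{(K)}\}$. Put $H(u)=\sum_{k}\sum_{i\in V_k}u_i/M_k$ and assume that $H(u)\le 1$ for all $u\in\Omega$, with strict inequality for $u\notin\Omega^*$; let $\zeta=1-\max_{u\in\Omega\setminus\Omega^*}H(u)>0$. Packets arrive at node $i$ as a Poisson process of rate $\rho_i=\hat\rho_k>0$ for $i\in V_k$; let $\rho=\sum_k\hat\rho_k$ and $\rho_{\min}=\min_k\hat\rho_k$. A node $i$ that is inactive and has no active neighbour activates at rate $\nu_i>0$; an active node completes a transmission at rate $1$, and then de-activates while its queue length decreases by one if it was positive. The activity process $U(t)\in\Omega$ is the Markov process with rates $q(u,u+e_i)=\nu_i$, $q(u+e_i,u)=1$ (for $u,u+e_i\in\Omega$);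 $\pi$ is its stationary distribution. The system is *stable* if the joint Markov process of activity states and queue lengths on $\Omega\times\mathbb N_0^V$ is positive recurrent. The mixing time is $t_{\rm mix}(\epsilon)=\inf\{t\ge 0: d(t)\le\epsilon\}$ (with $\inf\emptyset=\infty$), where $d(t)=\max_{U(0)\in\Omega}\frac12\sum_{u\in\Omega}|P(U(t)=u)-\pi(u)|$. **The exponent.** For $u\neq v$ in $\Omega$ let $M(u,v)$ be the maximum, over all paths $u=u^{(0)},\dots,u^{(n)}=v$ in $\Omega$ with $q(u^{(j)},u^{(j+1)})>0$, of $\min_j H(u^{(j)})$, and let $M(u,u)=\infty$. Let $w\in\mathbb R_{\ge0}^V$, $w\ne0$. For $T\subseteq V_k$ with $w_i>0$ for some $i\in T$, let $\Delta(T)=\{u\in\Omega:\sum_{i\in T}w_i\rho_i\le\sum_{i\in T}w_iu_i\}$. For $l\ne k$ let $m_l(T)=\max_{u\in\Delta(T)}M(v^{(l)},u)$ and $S_l(T)=\{u\in\Omega:M(v^{(l)},u)>m_l(T)\}$; let $m_k(T)=\max_{l\neq k}m_l(T)$ and $S_k(T)=\{v\in\Omega:\max_{u\in\Delta(T)}M(u,v)>m_k(T)\}$.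 With $\partial S=\{u\in S:\sum_{u'\notin S}q(u,u')>0\}$, let $H_l(T)=\max_{u\in\partial S_l(T)}H(u)$, $H^*(T)=\min_{l=1,\dots,K}H_l(T)$, and let $H^*_{\min}$ be the minimum of $H^*(T)$ over all such sets $T$ (over all $k$). **Theorem.** Let $0<\gamma<1/4$ and assume $\rho\ge 1-\gamma\zeta\rho_{\min}^2$. For any activation rates $(\nu_i)_{i\in V}$ with $\nu_i=\nu_j$ whenever $i,j$ are in the same component and such that the system is stable, for any such $w$, and for every $\epsilon\in\mathbb R$, $$t_{\rm mix}(\epsilon)>\bigl((1-\gamma)\rho_{\min}-2\epsilon\bigr)\,\frac{(1-4\gamma)\,\rho_{\min}^{M+2}}{2^N}\left(\frac1{1-\rho}\right)^{M(1-H^*_{\min})}.$$ -/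

import Mathlib

open scoped ENNReal Classical

noncomputable section

namespace RandomAccess

/-! ### Continuous-time Markov chains given by their transition rates -/

section Markov

variable {S : Type*}

/-- Total rate out of a state (`q x y` is the rate of the transition `x → y`, `q x x = 0`). -/
def exitRate (q : S → S → ℝ) (x : S) : ℝ≥0∞ := ∑' y, ENNReal.ofReal (q x y)

/-- `tabooProb q s n y` is the probability that the jump chain started in `s` is in `y` after
`n` jumps and has not returned to `s` in jumps `1, …, n`. -/
def tabooProb (q : S → S → ℝ) (s : S) : ℕ → S → ℝ≥0∞
  | 0, y => if y = s then 1 else 0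
  | n + 1, y =>
      if y = s then 0
      else ∑' x, tabooProb q s n x * (ENNReal.ofReal (q x y) / exitRate q x)

/-- Mean time until the first return to `s`, starting in `s`: the `n`-th visited state `y`
contributes its mean holding time `1 / exitRate q y` as long as `s` has not been revisited. -/
def meanReturnTime (q : S → S → ℝ) (s : S) : ℝ≥0∞ :=
  ∑' n, ∑' y, tabooProb q s n y * (exitRate q y)⁻¹

/-- Positive recurrence: all mean return times are finite. -/
def PositiveRecurrent (q : S → S → ℝ) : Prop := ∀ s, meanReturnTime q s < ∞

variable [Fintype S]

/-- Generator matrix of a finite chain. -/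
def generator (q : S → S → ℝ) : Matrix S S ℝ :=
  Matrix.of fun x y => if x = y then -∑ z ∈ Finset.univ.erase x, q x z else q x y

/-- `transitionProb q t x y = P(U(t) = y ∣ U(0) = x)`. -/
def transitionProb (q : S → S → ℝ) (t : ℝ) : Matrix S S ℝ :=
  NormedSpace.exp (t • generator q)

/-- Stationary probability distributions of a finite chain. -/
def IsStationary (q : S → S → ℝ) (π : S → ℝ) : Prop :=
  (∀ x, 0 ≤ π x) ∧ ∑ x, π x = 1 ∧ Matrix.vecMul π (generator q) = 0

/-- `d(t)`: the maximal total variation distance to `π` at time `t`, over the initial states. -/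
def maxDist (q : S → S → ℝ) (π : S → ℝ) (t : ℝ) : ℝ :=
  ⨆ x : S, (1 / 2) * ∑ y, |transitionProb q t x y - π y|

/-- `t_mix(ε) = inf {t ≥ 0 : d(t) ≤ ε}`, equal to `⊤` if there is no such `t`. -/
def mixingTime (q : S → S → ℝ) (π : S → ℝ) (ε : ℝ) : EReal :=
  ⨅ t ∈ {t : ℝ | 0 ≤ t ∧ maxDist q π t ≤ ε}, (t : EReal)

end Markov

/-! ### The random-access network -/

section Network

variable {V : Type*}

/-- Feasible joint activity states `Ω`, each given by its independent set of active nodes. -/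
abbrev State (G : SimpleGraph V) : Type _ := {u : Finset V // G.IsIndepSet (u : Set V)}

/-- Transition rates of the activity process: an unblocked node `i` activates at rate `ν i`
and an active node de-activates at rate `1`. (A node `i ∉ u` is unblocked in `u` exactly when
`insert i u` is again feasible.) -/
def activityRate [Fintype V] (G : SimpleGraph V) (ν : V → ℝ) (u u' : State G) : ℝ :=
  (∑ i, if i ∉ u.1 ∧ u'.1 = insert i u.1 then ν i else 0) +
    ∑ i, if i ∈ u.1 ∧ u'.1 = u.1.erase i then 1 else 0

/-- Transition rates of the joint process of activity states and queue lengths: packets arrive at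
node `i` at rate `lam i`; an unblocked node `i` activates at rate `ν i`; an active node completes a
transmission at rate `1`, upon which it de-activates and a packet, if there is one, leaves the queue
(subtraction of natural numbers is truncated, which covers the dummy packets). -/
def queueRate [Fintype V] (G : SimpleGraph V) (lam ν : V → ℝ)
    (s s' : State G × (V → ℕ)) : ℝ :=
  (∑ i, if s'.1 = s.1 ∧ s'.2 = s.2 + Pi.single i 1 then lam i else 0) +
    (∑ i, if i ∉ s.1.1 ∧ s'.1.1 = insert i s.1.1 ∧ s'.2 = s.2 then ν i else 0) +
    ∑ i, if i ∈ s.1.1 ∧ s'.1.1 = s.1.1.erase i ∧ s'.2 = s.2 - Pi.single i 1 then 1 else 0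

/-- The network is stable. -/
def Stable [Fintype V] (G : SimpleGraph V) (lam ν : V → ℝ) : Prop :=
  PositiveRecurrent (queueRate G lam ν)

end Network

/-! ### Partite interference graphs: the components are the colour classes of a colouring -/

section Partite

variable {V : Type*} [Fintype V] {G : SimpleGraph V} {K : ℕ}

/-- The component `V_k`. -/
def component (c : G.Coloring (Fin K)) (k : Fin K) : Finset V :=
  Finset.univ.filter fun i => c i = k

/-- The component size `M_k`. -/
def compSize (c : G.Coloring (Fin K)) (k : Fin K) : ℕ := (component c k).card

/-- The maximum component size `M`. -/
def maxCompSize (c : G.Coloring (Fin K)) : ℕ := Finset.univ.sup (compSize c)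

/-- The state `v^(k)` in which precisely the nodes of `V_k` are active. -/
def fullState (c : G.Coloring (Fin K)) (k : Fin K) : State G :=
  ⟨component c k, by
    intro i hi j hj _ hadj
    simp only [component, Finset.coe_filter, Finset.mem_univ, true_and, Set.mem_ofPred_eq] at hi hj
    exact c.valid hadj (hi.trans hj.symm)⟩

/-- `Ω*`. -/
def fullStates (c : G.Coloring (Fin K)) : Set (State G) := Set.range (fullState c)

/-- `H(u) = ∑_k ∑_{i ∈ V_k} u_i / M_k`. -/
def H (c : G.Coloring (Fin K)) (u : State G) : ℝ :=
  ∑ k, ∑ i ∈ component c k, (if i ∈ u.1 then 1 else 0) / (compSize c k : ℝ)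

/-- `ζ = 1 - max_{u ∈ Ω \ Ω*} H(u)`. -/
def zeta (c : G.Coloring (Fin K)) : ℝ := 1 - sSup (H c '' (fullStates c)ᶜ)

/-- Paths from `u` to `v` with `l` steps, each of them a transition of positive rate. -/
def IsPath (ν : V → ℝ) (u v : State G) {l : ℕ} (p : Fin (l + 1) → State G) : Prop :=
  p 0 = u ∧ p (Fin.last l) = v ∧ ∀ j : Fin l, 0 < activityRate G ν (p j.castSucc) (p j.succ)

/-- `M(u, v)`: the maximum over all paths from `u` to `v` of the minimum of `H` along the path,
with `M(u, u) = ∞`. -/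
def pathMax (c : G.Coloring (Fin K)) (ν : V → ℝ) (u v : State G) : EReal :=
  if u = v then ⊤
  else ⨆ (l : ℕ) (p : Fin (l + 1) → State G) (_ : IsPath ν u v p), ⨅ j, (H c (p j) : EReal)

/-- `Δ(T)`: the states in which the drift of the weighted queue length in `T` is non-positive. -/
def Delta (G : SimpleGraph V) (lam w : V → ℝ) (T : Finset V) : Set (State G) :=
  {u | ∑ i ∈ T, w i * lam i ≤ ∑ i ∈ T, w i * (if i ∈ u.1 then 1 else 0)}

/-- `m_l(T) = max_{u ∈ Δ(T)} M(v^(l), u)`, used for `T ⊆ V_k`, `l ≠ k`. -/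
def mOther (c : G.Coloring (Fin K)) (lam ν w : V → ℝ) (T : Finset V) (l : Fin K) : EReal :=
  ⨆ u ∈ Delta G lam w T, pathMax c ν (fullState c l) u

/-- `m_k(T) = max_{l ≠ k} m_l(T)`, for `T ⊆ V_k`. -/
def mOwn (c : G.Coloring (Fin K)) (lam ν w : V → ℝ) (k : Fin K) (T : Finset V) : EReal :=
  ⨆ l ∈ {l : Fin K | l ≠ k}, mOther c lam ν w T l

/-- `S_l(T)`, for `T ⊆ V_k`. -/
def bottleneckSet (c : G.Coloring (Fin K)) (lam ν w : V → ℝ) (k : Fin K) (T : Finset V) (l : Fin K) :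
    Set (State G) :=
  if l = k then {v | mOwn c lam ν w k T < ⨆ u ∈ Delta G lam w T, pathMax c ν u v}
  else {u | mOther c lam ν w T l < pathMax c ν (fullState c l) u}

/-- The boundary `∂S` of a set of states. -/
def boundary (ν : V → ℝ) (B : Set (State G)) : Set (State G) :=
  {u | u ∈ B ∧ 0 < ∑ u' : State G, if u' ∉ B then activityRate G ν u u' else 0}

/-- `H_l(T) = max_{u ∈ ∂S_l(T)} H(u)`, for `T ⊆ V_k`. -/
def Hl (c : G.Coloring (Fin K)) (lam ν w : V → ℝ) (k : Fin K) (T : Finset V) (l : Fin K) : ℝ :=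
  sSup (H c '' boundary ν (bottleneckSet c lam ν w k T l))

/-- `H*(T) = min_l H_l(T)`, for `T ⊆ V_k`. -/
def Hstar (c : G.Coloring (Fin K)) (lam ν w : V → ℝ) (k : Fin K) (T : Finset V) : ℝ :=
  ⨅ l, Hl c lam ν w k T l

/-- `H*_min`: the minimum of `H*(T)` over the sets `T` that are contained in a single component
and carry positive weight. (For strictly positive weights: over the non-empty `T`.) -/
def HstarMin (c : G.Coloring (Fin K)) (lam ν w : V → ℝ) : ℝ :=
  sInf {x | ∃ (k : Fin K) (T : Finset V),
    T ⊆ component c k ∧ (∃ i ∈ T, 0 < w i) ∧ x = Hstar c lam ν w k T}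

end Partite

end RandomAccess

end

/-! The chain must cross a bottleneck that is rarely used in stationarity. For every set `A`,
`mul_sub_maxDist_le` gives π(A)(π(Aᶜ) - d(t)) ≤ t · flow(A), so it suffices to find `A` with small
flow whose mass and complementary mass are both bounded below. `A` is a set S_l(T) attaining H*_min.

Stability enters through throughput: a finite invariant measure of the joint process, tested against
truncated queue lengths, shows that node `i` is active for a fraction at least ρ_i of the time
(`Stable.le_sum`). Averaging over components gives E[1 - H] ≤ 1 - ρ under π, with two consequences.
(1) The mass outside Ω* is at most (1 - ρ)/ζ ≤ γρ_min², and within Ω* a node of V_k is active only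
in v^(k). Hence π(v^(k)) ≥ ρ_min - γρ_min² for every `k`. Since S_l(T) contains one full state and
misses another (`exists_fullState_mem_notMem`), both sides of the cut have mass at least (1 -
γ)ρ_min. (2) The states v^(k) with one node removed together contribute π(v^(k))/ν_i to E[1 - H], so
every ν_i is at least y = (7/8)ρ_min/(1 - ρ) (`fullState_le_mul_rate`). The product form of π then
gives π(u) ≤ y^(M(H(u) - 1)) (`IsStationary.le_rpow`).

Activations never leave S_l(T) (`exists_erase_of_exit`), so its exits are de-activations at rate 1
from boundary states, where H ≤ H*_min. Summing the bounds of (2) over these states yields flow ≤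
2^N ρ_min^(-M) (1 - ρ)^(M(1 - H*_min)). -/

noncomputable section

namespace RandomAccess

section Markov

/-! ### Invariant measures from finite mean return times. -/

section Countable

variable {S : Type*}

/-- If the mean return time to `s` is finite then the expected occupation times between two visits
of `s` form a finite non-zero invariant measure. -/
theorem exists_invariant_measure {q : S → S → ℝ} {s : S} {C : ℝ≥0∞} (hC : C ≠ ∞)
    (hle : ∀ y, exitRate q y ≤ C) (h0 : ∀ y, exitRate q y ≠ 0) (hs : meanReturnTime q s < ∞) :
    ∃ μ : S → ℝ≥0∞, ∑' y, μ y ≠ ∞ ∧ μ s ≠ 0 ∧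
      ∀ y, ∑' x, μ x * ENNReal.ofReal (q x y) = μ y * exitRate q y := by
  have htop : ∀ y, exitRate q y ≠ ∞ := fun y => ne_top_of_le_ne_top hC (hle y)
  -- `m y` is the expected number of visits to `y` per excursion from `s`, and `F` is the image of
  -- `m` under the jump chain.
  set m : S → ℝ≥0∞ := fun y => ∑' n, tabooProb q s n y with hm
  set F : S → ℝ≥0∞ := fun y => ∑' x, m x * (exitRate q x)⁻¹ * ENNReal.ofReal (q x y) with hF
  have hsum : ∑' y, m y * (exitRate q y)⁻¹ ≠ ∞ := by
    have : ∑' y, m y * (exitRate q y)⁻¹ = meanReturnTime q s := by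
      simp only [hm, ← ENNReal.tsum_mul_right]
      exact ENNReal.tsum_comm
    rw [this]; exact hs.ne
  have hmtot : ∑' y, m y ≠ ∞ := by
    -- Exit rates are at most `C`, so the number of visits is at most `C` times the time spent.
    refine ne_top_of_le_ne_top (ENNReal.mul_ne_top hsum hC) ?_
    rw [← ENNReal.tsum_mul_right]
    refine ENNReal.tsum_le_tsum fun y => ?_
    rw [mul_assoc]
    calc m y = m y * ((exitRate q y)⁻¹ * exitRate q y) := by
          rw [ENNReal.inv_mul_cancel (h0 y) (htop y), mul_one]
      _ ≤ _ := by gcongr; exact hle y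
  have hms : m s = 1 := by
    simp only [hm]
    rw [tsum_eq_single 0]
    · simp [tabooProb]
    · intro n hn
      obtain ⟨k, rfl⟩ := Nat.exists_eq_succ_of_ne_zero hn
      simp [tabooProb]
  have hFeq : ∀ y, F y =
      ∑' n, ∑' x, tabooProb q s n x * (ENNReal.ofReal (q x y) / exitRate q x) := by
    intro y
    rw [ENNReal.tsum_comm]
    refine tsum_congr fun x => ?_
    rw [ENNReal.tsum_mul_right, mul_assoc, div_eq_mul_inv, mul_comm (_⁻¹)]
  have hne : ∀ y, y ≠ s → F y = m y := by
    intro y hy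
    rw [hFeq]
    simp only [hm]
    rw [tsum_eq_zero_add' (f := fun n => tabooProb q s n y) ENNReal.summable]
    simp [tabooProb, hy]
  have hFtot : ∑' y, F y = ∑' y, m y := by
    simp only [hF]
    rw [ENNReal.tsum_comm]
    refine tsum_congr fun x => ?_
    rw [ENNReal.tsum_mul_left, mul_assoc]
    change m x * ((exitRate q x)⁻¹ * exitRate q x) = m x
    rw [ENNReal.inv_mul_cancel (h0 x) (htop x), mul_one]
  -- At `s` the taboo recursion says nothing; equality follows because `F` and `m` have the same
  -- finite total mass and agree elsewhere.
  have hFs : F s = m s := by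
    have h1 := ENNReal.tsum_eq_add_tsum_ite (f := F) s
    have h2 := ENNReal.tsum_eq_add_tsum_ite (f := m) s
    have h3 : ∑' x, (if x = s then 0 else F x) = ∑' x, if x = s then 0 else m x := by
      refine tsum_congr fun x => ?_
      split_ifs with h
      · rfl
      · exact hne x h
    rw [h3, hFtot, h2] at h1
    refine ((ENNReal.add_left_inj ?_).1 h1).symm
    exact ne_top_of_le_ne_top hmtot (by rw [h2]; exact le_add_self)
  refine ⟨fun y => m y * (exitRate q y)⁻¹, hsum, ?_, fun y => ?_⟩
  · simp only [hms, one_mul]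
    exact ENNReal.inv_ne_zero.2 (htop s)
  · change F y = _
    rw [mul_assoc, ENNReal.inv_mul_cancel (h0 y) (htop y), mul_one]
    by_cases hy : y = s
    · rw [hy, hFs]
    · exact hne y hy

/-- Global balance, tested against a non-negative function. -/
theorem tsum_mul_exitRate_mul {q : S → S → ℝ} {μ : S → ℝ≥0∞}
    (hμ : ∀ y, ∑' x, μ x * ENNReal.ofReal (q x y) = μ y * exitRate q y) (f : S → ℝ≥0∞) :
    ∑' x, μ x * ∑' y, ENNReal.ofReal (q x y) * f x =
      ∑' x, μ x * ∑' y, ENNReal.ofReal (q x y) * f y := by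
  have h1 : ∀ x, μ x * ∑' y, ENNReal.ofReal (q x y) * f x = (μ x * exitRate q x) * f x := by
    intro x; rw [ENNReal.tsum_mul_right, mul_assoc]; rfl
  simp only [h1, ← hμ, ← ENNReal.tsum_mul_right, ← ENNReal.tsum_mul_left]
  rw [ENNReal.tsum_comm]
  simp only [mul_assoc]

end Countable

/-! ### Finite chains: semigroup, bottleneck inequality, reversibility. -/

section Finite

variable {S : Type*} [Fintype S]

theorem generator_nonneg_of_ne {q : S → S → ℝ} (hq : ∀ x y, 0 ≤ q x y) {x y : S} (h : x ≠ y) :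
    0 ≤ generator q x y := by
  simp [generator, h, hq]

theorem sum_generator (q : S → S → ℝ) (x : S) : ∑ y, generator q x y = 0 := by
  rw [← Finset.add_sum_erase _ _ (Finset.mem_univ x)]
  simp only [generator, Matrix.of_apply, if_true]
  rw [neg_add_eq_zero]
  refine Finset.sum_congr rfl fun y hy => ?_
  rw [if_neg (Finset.ne_of_mem_erase hy).symm]

theorem sum_mul_generator {q : S → S → ℝ} {π : S → ℝ} (hπ : IsStationary q π) (y : S) :
    ∑ x, π x * generator q x y = 0 := congrFun hπ.2.2 y

theorem transitionProb_zero (q : S → S → ℝ) : transitionProb q 0 = 1 := by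
  simp [transitionProb]

section Norm

open scoped Matrix.Norms.Operator

theorem hasDerivAt_transitionProb (q : S → S → ℝ) (t : ℝ) :
    HasDerivAt (transitionProb q) (transitionProb q t * generator q) t :=
  hasDerivAt_exp_smul_const (𝕂 := ℝ) (generator q) t

theorem hasDerivAt_transitionProb' (q : S → S → ℝ) (t : ℝ) :
    HasDerivAt (transitionProb q) (generator q * transitionProb q t) t :=
  hasDerivAt_exp_smul_const' (𝕂 := ℝ) (generator q) t

/-- The forward equation; it serves for row sums and escape probabilities, while its backward
counterpart serves for invariance of π. -/
theorem hasDerivAt_linear_transitionProb (q : S → S → ℝ) (L : Matrix S S ℝ →ₗ[ℝ] ℝ) (t : ℝ) :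
    HasDerivAt (fun t => L (transitionProb q t)) (L (transitionProb q t * generator q)) t :=
  (LinearMap.toContinuousLinearMap L).hasFDerivAt.comp_hasDerivAt t (hasDerivAt_transitionProb q t)

theorem hasDerivAt_linear_transitionProb' (q : S → S → ℝ) (L : Matrix S S ℝ →ₗ[ℝ] ℝ) (t : ℝ) :
    HasDerivAt (fun t => L (transitionProb q t)) (L (generator q * transitionProb q t)) t :=
  (LinearMap.toContinuousLinearMap L).hasFDerivAt.comp_hasDerivAt t (hasDerivAt_transitionProb' q t)

theorem exp_entry_nonneg {A : Matrix S S ℝ} (hA : ∀ x y, 0 ≤ A x y) (x y : S) :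
    0 ≤ NormedSpace.exp A x y := by
  have hpow : ∀ n : ℕ, ∀ x y, 0 ≤ (A ^ n) x y := by
    intro n
    induction n with
    | zero => intro x y; rw [pow_zero, Matrix.one_apply]; split_ifs <;> norm_num
    | succ n ih =>
      intro x y
      rw [pow_succ, Matrix.mul_apply]
      exact Finset.sum_nonneg fun z _ => mul_nonneg (ih x z) (hA z y)
  have h := NormedSpace.exp_series_hasSum_exp' (𝕂 := ℝ) A
  have h2 := (h.map (Matrix.entryLinearMap ℝ ℝ x y)
    (LinearMap.continuous_of_finiteDimensional (Matrix.entryLinearMap ℝ ℝ x y)))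
  refine h2.nonneg fun n => ?_
  simp only [Function.comp, Matrix.entryLinearMap_apply, Matrix.smul_apply, smul_eq_mul]
  exact mul_nonneg (by positivity) (hpow n x y)

end Norm

/-- Uniformization: adding a large multiple c of the identity makes the exponent entrywise
non-negative and changes the exponential only by the factor exp(c). -/
theorem transitionProb_nonneg {q : S → S → ℝ} (hq : ∀ x y, 0 ≤ q x y) {t : ℝ} (ht : 0 ≤ t)
    (x y : S) : 0 ≤ transitionProb q t x y := by
  set c : ℝ := ∑ z, |t * generator q z z| with hc
  have hA : ∀ x y, 0 ≤ (t • generator q + Matrix.diagonal (fun _ : S => c)) x y := by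
    intro x y
    by_cases h : x = y
    · subst h
      simp only [Matrix.add_apply, Matrix.smul_apply, smul_eq_mul, Matrix.diagonal_apply_eq]
      have := Finset.single_le_sum (f := fun z => |t * generator q z z|)
        (fun z _ => abs_nonneg _) (Finset.mem_univ x)
      have h2 := neg_abs_le (t * generator q x x)
      linarith
    · simp only [Matrix.add_apply, Matrix.smul_apply, smul_eq_mul, Matrix.diagonal_apply_ne _ h,
        add_zero]
      exact mul_nonneg ht (generator_nonneg_of_ne hq h)
  have hsplit : transitionProb q t = NormedSpace.exp (Matrix.diagonal (fun _ : S => -c)) *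
      NormedSpace.exp (t • generator q + Matrix.diagonal (fun _ : S => c)) := by
    rw [transitionProb, ← Matrix.exp_add_of_commute]
    · congr 1
      rw [add_comm, add_assoc, Matrix.diagonal_add]
      simp
    · have : (Matrix.diagonal (fun _ : S => -c)) = (-c) • (1 : Matrix S S ℝ) := by
        rw [Matrix.smul_one_eq_diagonal]
      rw [this]
      exact (Commute.one_left _).smul_left _
  rw [hsplit, Matrix.exp_diagonal, Matrix.diagonal_mul]
  refine mul_nonneg ?_ (exp_entry_nonneg hA x y)
  rw [Pi.coe_exp, ← Real.exp_eq_exp_ℝ]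
  exact (Real.exp_pos _).le

/-- A functional whose derivative along the semigroup vanishes is constant. -/
theorem linear_transitionProb_eq (q : S → S → ℝ) (L : Matrix S S ℝ →ₗ[ℝ] ℝ)
    (h : (∀ t, L (transitionProb q t * generator q) = 0) ∨
      ∀ t, L (generator q * transitionProb q t) = 0) (t : ℝ) :
    L (transitionProb q t) = L 1 := by
  have hd : ∀ t, HasDerivAt (fun t => L (transitionProb q t)) 0 t := by
    intro t
    rcases h with h | h
    · rw [← h t]; exact hasDerivAt_linear_transitionProb q L t
    · rw [← h t]; exact hasDerivAt_linear_transitionProb' q L t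
  have := is_const_of_deriv_eq_zero (fun t => (hd t).differentiableAt) (fun t => (hd t).deriv) t 0
  simpa [transitionProb_zero] using this

theorem sum_transitionProb (q : S → S → ℝ) (t : ℝ) (x : S) : ∑ y, transitionProb q t x y = 1 := by
  have := linear_transitionProb_eq q (∑ y, Matrix.entryLinearMap ℝ ℝ x y) (Or.inl fun t => ?_) t
  · simpa [Matrix.one_apply] using this
  · simp only [LinearMap.sum_apply, Matrix.entryLinearMap_apply, Matrix.mul_apply]
    rw [Finset.sum_comm]
    simp [← Finset.mul_sum, sum_generator]

theorem sum_mul_transitionProb {q : S → S → ℝ} {π : S → ℝ} (hπ : IsStationary q π) (t : ℝ) (y : S) :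
    ∑ x, π x * transitionProb q t x y = π y := by
  have := linear_transitionProb_eq q (∑ x, π x • Matrix.entryLinearMap ℝ ℝ x y)
    (Or.inr fun t => ?_) t
  · simpa [Matrix.one_apply] using this
  · simp only [LinearMap.sum_apply, LinearMap.smul_apply, Matrix.entryLinearMap_apply,
      Matrix.mul_apply, smul_eq_mul, Finset.mul_sum]
    rw [Finset.sum_comm]
    simp only [← mul_assoc]
    simp [← Finset.sum_mul, sum_mul_generator hπ]

/-- The stationary flow from `A` to its complement. -/
def flow [DecidableEq S] (q : S → S → ℝ) (π : S → ℝ) (A : Finset S) : ℝ :=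
  ∑ x ∈ A, ∑ y ∈ Aᶜ, π x * q x y

/-- The derivative of the escaped mass is the net flow into `Aᶜ` of the chain started from π
restricted to `A`. That law stays below π at all times, so the inflow from `A` is at most the
stationary flow, and states of `Aᶜ` can only lose mass to `A`. -/
theorem sum_escape_le [DecidableEq S] {q : S → S → ℝ} (hq : ∀ x y, 0 ≤ q x y) {π : S → ℝ} (hπ : IsStationary q π)
    (A : Finset S) {t : ℝ} (ht : 0 ≤ t) :
    ∑ x ∈ A, ∑ y ∈ Aᶜ, π x * transitionProb q t x y ≤ t * flow q π A := by
  set L : Matrix S S ℝ →ₗ[ℝ] ℝ := ∑ x ∈ A, ∑ y ∈ Aᶜ, π x • Matrix.entryLinearMap ℝ ℝ x y with hL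
  have hLapp : ∀ B : Matrix S S ℝ, L B = ∑ x ∈ A, ∑ y ∈ Aᶜ, π x * B x y := by
    intro B
    simp [hL, LinearMap.sum_apply]
  have hbound : ∀ t, 0 ≤ t → L (transitionProb q t * generator q) ≤ flow q π A := by
    intro t ht
    have h1 : L (transitionProb q t * generator q) =
        ∑ z, (∑ x ∈ A, π x * transitionProb q t x z) * ∑ y ∈ Aᶜ, generator q z y := by
      rw [hLapp]
      simp only [Matrix.mul_apply, Finset.mul_sum, Finset.sum_mul]
      have : ∀ x ∈ A, ∑ y ∈ Aᶜ, ∑ z, π x * (transitionProb q t x z * generator q z y) =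
          ∑ z, ∑ y ∈ Aᶜ, π x * transitionProb q t x z * generator q z y := by
        intro x _
        rw [Finset.sum_comm]
        simp only [mul_assoc]
      rw [Finset.sum_congr rfl this, Finset.sum_comm]
      exact Finset.sum_congr rfl fun z _ => Finset.sum_comm
    have hnn : ∀ z, 0 ≤ ∑ x ∈ A, π x * transitionProb q t x z := fun z =>
      Finset.sum_nonneg fun x _ => mul_nonneg (hπ.1 x) (transitionProb_nonneg hq ht x z)
    have hle : ∀ z, ∑ x ∈ A, π x * transitionProb q t x z ≤ π z := fun z => by
      rw [← sum_mul_transitionProb hπ t z]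
      exact Finset.sum_le_univ_sum_of_nonneg fun x =>
        mul_nonneg (hπ.1 x) (transitionProb_nonneg hq ht x z)
    rw [h1, ← Finset.sum_add_sum_compl A, flow]
    have hneg : ∑ z ∈ Aᶜ, (∑ x ∈ A, π x * transitionProb q t x z) * ∑ y ∈ Aᶜ, generator q z y
        ≤ 0 := by
      refine Finset.sum_nonpos fun z hz => mul_nonpos_of_nonneg_of_nonpos (hnn z) ?_
      have h2 := sum_generator q z
      rw [← Finset.sum_add_sum_compl A] at h2
      have h3 : 0 ≤ ∑ y ∈ A, generator q z y := Finset.sum_nonneg fun y hy =>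
        generator_nonneg_of_ne hq (by rintro rfl; exact (Finset.mem_compl.1 hz) hy)
      linarith
    have hpos : ∑ z ∈ A, (∑ x ∈ A, π x * transitionProb q t x z) * ∑ y ∈ Aᶜ, generator q z y
        ≤ ∑ x ∈ A, ∑ y ∈ Aᶜ, π x * q x y := by
      refine Finset.sum_le_sum fun z hz => ?_
      rw [← Finset.mul_sum]
      have : ∑ y ∈ Aᶜ, generator q z y = ∑ y ∈ Aᶜ, q z y := by
        refine Finset.sum_congr rfl fun y hy => ?_
        have : z ≠ y := by rintro rfl; exact (Finset.mem_compl.1 hy) hz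
        simp [generator, this]
      rw [this]
      exact mul_le_mul_of_nonneg_right (hle z) (Finset.sum_nonneg fun y _ => hq z y)
    linarith
  have hdiff : ∀ t, HasDerivAt (fun t => L (transitionProb q t)) _ t :=
    hasDerivAt_linear_transitionProb q L
  have hmv := (convex_Ici (0 : ℝ)).image_sub_le_mul_sub_of_deriv_le
    (f := fun t => L (transitionProb q t)) (C := flow q π A)
    (fun t _ => (hdiff t).continuousAt.continuousWithinAt)
    (fun t _ => (hdiff t).differentiableAt.differentiableWithinAt)
    (fun t h => by rw [(hdiff t).deriv]; exact hbound t (interior_subset h))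
    0 Set.self_mem_Ici t ht ht
  have h0 : L (transitionProb q 0) = 0 := by
    rw [transitionProb_zero, hLapp]
    refine Finset.sum_eq_zero fun x hx => Finset.sum_eq_zero fun y hy => ?_
    have : x ≠ y := by rintro rfl; exact (Finset.mem_compl.1 hy) hx
    simp [this]
  simp only [h0, sub_zero] at hmv
  rw [← hLapp]
  linarith

/-- The positive and negative parts of π - P_t(x, ·) have equal mass, so each is half of the ℓ¹
distance. -/
theorem sum_sub_le_maxDist [DecidableEq S] {q : S → S → ℝ} {π : S → ℝ} (hπ : IsStationary q π) (A : Finset S)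
    (t : ℝ) (x : S) : ∑ y ∈ A, (π y - transitionProb q t x y) ≤ maxDist q π t := by
  refine le_trans ?_ (le_ciSup (f := fun x : S => (1 / 2) * ∑ y, |transitionProb q t x y - π y|)
    (Set.finite_range _).bddAbove x)
  have h0 : ∑ y, (π y - transitionProb q t x y) = 0 := by
    rw [Finset.sum_sub_distrib, hπ.2.1, sum_transitionProb, sub_self]
  rw [← Finset.sum_add_sum_compl A] at h0
  have h1 : ∑ y ∈ A, (π y - transitionProb q t x y) ≤ ∑ y ∈ A, |transitionProb q t x y - π y| :=
    Finset.sum_le_sum fun y _ => by rw [abs_sub_comm]; exact le_abs_self _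
  have h2 : -∑ y ∈ Aᶜ, (π y - transitionProb q t x y) ≤
      ∑ y ∈ Aᶜ, |transitionProb q t x y - π y| := by
    rw [← Finset.sum_neg_distrib]
    exact Finset.sum_le_sum fun y _ => by rw [neg_sub]; exact le_abs_self _
  rw [← Finset.sum_add_sum_compl A (fun y => |transitionProb q t x y - π y|)]
  linarith

/-- The bottleneck inequality. -/
theorem mul_sub_maxDist_le [DecidableEq S] {q : S → S → ℝ} (hq : ∀ x y, 0 ≤ q x y) {π : S → ℝ}
    (hπ : IsStationary q π) (A : Finset S) {t : ℝ} (ht : 0 ≤ t) :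
    (∑ x ∈ A, π x) * ((∑ x ∈ Aᶜ, π x) - maxDist q π t) ≤ t * flow q π A := by
  refine le_trans ?_ (sum_escape_le hq hπ A ht)
  rw [Finset.sum_mul]
  refine Finset.sum_le_sum fun x _ => ?_
  rw [← Finset.mul_sum]
  refine mul_le_mul_of_nonneg_left ?_ (hπ.1 x)
  have := sum_sub_le_maxDist hπ Aᶜ t x
  rw [Finset.sum_sub_distrib] at this
  linarith

theorem maxDist_nonneg [Nonempty S] (q : S → S → ℝ) (π : S → ℝ) (t : ℝ) : 0 ≤ maxDist q π t :=
  Real.iSup_nonneg fun _ => mul_nonneg (by norm_num) (Finset.sum_nonneg fun _ _ => abs_nonneg _)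

/-- A reversible chain has, up to a constant factor, constant density with respect to its
reversible measure along transitions of positive rate. -/
theorem IsStationary.div_eq_div {q : S → S → ℝ} (hq : ∀ x y, 0 ≤ q x y) {b π : S → ℝ}
    (hb : ∀ x, 0 < b x) (hrev : ∀ x y, b x * q x y = b y * q y x) (hπ : IsStationary q π)
    {x y : S} (hxy : 0 < q x y) : π x / b x = π y / b y := by
  set h : S → ℝ := fun x => π x / b x with hh
  have hπb : ∀ x, π x = b x * h x := fun x => by simp only [hh]; field_simp [(hb x).ne']
  have hgen : ∀ v, ∑ u, b v * q v u * (h u - h v) = 0 := by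
    intro v
    have h1 := sum_mul_generator hπ v
    rw [← Finset.add_sum_erase _ _ (Finset.mem_univ v)] at h1 ⊢
    have h2 : π v * generator q v v = -∑ u ∈ Finset.univ.erase v, b v * q v u * h v := by
      simp only [generator, Matrix.of_apply, if_true, hπb v, mul_neg, Finset.mul_sum]
      congr 1
      exact Finset.sum_congr rfl fun u _ => by ring
    have h3 : ∑ u ∈ Finset.univ.erase v, π u * generator q u v =
        ∑ u ∈ Finset.univ.erase v, b v * q v u * h u := by
      refine Finset.sum_congr rfl fun u hu => ?_
      simp only [generator, Matrix.of_apply, if_neg (Finset.ne_of_mem_erase hu), hπb u]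
      rw [← hrev u v]; ring
    rw [h2, h3] at h1
    simp only [sub_self, mul_zero, zero_add, mul_sub, Finset.sum_sub_distrib]
    linarith
  -- By reversibility stationarity makes the density `h` harmonic, so its Dirichlet form vanishes;
  -- every term is a non-negative square.
  have hE : ∑ v, ∑ u, b v * q v u * (h u - h v) ^ 2 = 0 := by
    have e1 : ∑ v, ∑ u, b v * q v u * (h u - h v) * h v = 0 := by
      refine Finset.sum_eq_zero fun v _ => ?_
      rw [← Finset.sum_mul, hgen, zero_mul]
    have e2 : ∑ v, ∑ u, b v * q v u * (h u - h v) * h u = 0 := by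
      rw [Finset.sum_comm]
      refine Finset.sum_eq_zero fun v _ => ?_
      have : ∀ u ∈ Finset.univ, b u * q u v * (h v - h u) * h v =
          -(b v * q v u * (h u - h v)) * h v := by
        intro u _; rw [hrev u v]; ring
      rw [Finset.sum_congr rfl this, ← Finset.sum_mul, Finset.sum_neg_distrib, hgen]
      simp
    have : ∑ v, ∑ u, b v * q v u * (h u - h v) ^ 2 =
        ∑ v, ∑ u, b v * q v u * (h u - h v) * h u -
          ∑ v, ∑ u, b v * q v u * (h u - h v) * h v := by
      rw [← Finset.sum_sub_distrib]
      refine Finset.sum_congr rfl fun v _ => ?_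
      rw [← Finset.sum_sub_distrib]
      exact Finset.sum_congr rfl fun u _ => by ring
    rw [this, e1, e2, sub_zero]
  have hnn : ∀ v u, 0 ≤ b v * q v u * (h u - h v) ^ 2 := fun v u =>
    mul_nonneg (mul_nonneg (hb v).le (hq v u)) (sq_nonneg _)
  have h4 := (Finset.sum_eq_zero_iff_of_nonneg
    (fun v _ => Finset.sum_nonneg fun u _ => hnn v u)).1 hE x (Finset.mem_univ x)
  have h5 := (Finset.sum_eq_zero_iff_of_nonneg (fun u _ => hnn x u)).1 h4 y (Finset.mem_univ y)
  have h6 : b x * q x y ≠ 0 := (mul_pos (hb x) hxy).ne'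
  have h7 : h y - h x = 0 := by
    rcases mul_eq_zero.1 h5 with h | h
    · exact absurd h h6
    · exact pow_eq_zero_iff (two_ne_zero) |>.1 h
  linarith

end Finite

end Markov

/-! ### The activity process and its product-form stationary law. -/

section RandomAccessNetwork

theorem isStationary_of_balance {S : Type*} [Fintype S] {q : S → S → ℝ} (hq : ∀ x, q x x = 0)
    {π : S → ℝ} (h0 : ∀ x, 0 ≤ π x) (h1 : ∑ x, π x = 1)
    (hbal : ∀ y, ∑ x, π x * q x y = π y * ∑ x, q y x) : IsStationary q π := by
  refine ⟨h0, h1, funext fun y => ?_⟩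
  change ∑ x, π x * generator q x y = 0
  have hb := hbal y
  rw [← Finset.add_sum_erase _ _ (Finset.mem_univ y), hq,
    ← Finset.add_sum_erase (f := fun x => q y x) (h := Finset.mem_univ y), hq] at hb
  rw [← Finset.add_sum_erase _ _ (Finset.mem_univ y)]
  have : ∑ x ∈ Finset.univ.erase y, π x * generator q x y =
      ∑ x ∈ Finset.univ.erase y, π x * q x y := by
    refine Finset.sum_congr rfl fun x hx => ?_
    simp [generator, Finset.ne_of_mem_erase hx]
  rw [this]
  simp only [generator, Matrix.of_apply, if_true]
  linarith

variable {V : Type*} {G : SimpleGraph V}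

/-- The state in which no node is active. -/
def emptyState (G : SimpleGraph V) : State G := ⟨∅, by simp [SimpleGraph.IsIndepSet]⟩

/-- The state after de-activation of `i`. -/
def eraseState (u : State G) (i : V) : State G :=
  ⟨u.1.erase i, u.2.mono (by simp)⟩

variable {ν : V → ℝ}

theorem insert_iff_erase {u u' : State G} {i : V} :
    (i ∉ u.1 ∧ u'.1 = insert i u.1) ↔ (i ∈ u'.1 ∧ u.1 = u'.1.erase i) := by
  constructor
  · rintro ⟨hi, h⟩
    rw [h]; exact ⟨Finset.mem_insert_self _ _, (Finset.erase_insert hi).symm⟩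
  · rintro ⟨hi, h⟩
    rw [h]; exact ⟨Finset.notMem_erase _ _, (Finset.insert_erase hi).symm⟩

/-- The product-form reversible measure. -/
def stateWeight (ν : V → ℝ) (u : State G) : ℝ := ∏ i ∈ u.1, ν i

theorem stateWeight_pos (hν : ∀ i, 0 < ν i) (u : State G) : 0 < stateWeight ν u :=
  Finset.prod_pos fun i _ => hν i

theorem stateWeight_insert {u u' : State G} {i : V} (hi : i ∉ u.1) (h : u'.1 = insert i u.1) :
    stateWeight ν u' = ν i * stateWeight ν u := by
  rw [stateWeight, h, Finset.prod_insert hi, stateWeight]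

/-- Monotonicity of Δ(T) is what prevents an activation from leaving S_k(T). -/
theorem mem_Delta_of_subset {lam w : V → ℝ} {T : Finset V} (hw : ∀ i, 0 ≤ w i) {u u' : State G} (hu : u ∈ Delta G lam w T)
    (h : u.1 ⊆ u'.1) : u' ∈ Delta G lam w T := by
  refine le_trans (show ∑ i ∈ T, w i * lam i ≤ _ from hu) (Finset.sum_le_sum fun i _ => ?_)
  refine mul_le_mul_of_nonneg_left ?_ (hw i)
  by_cases hi : i ∈ u.1
  · simp [hi, h hi]
  · rw [if_neg hi]; split_ifs <;> norm_num

variable [Fintype V]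

theorem activityRate_nonneg (hν : ∀ i, 0 < ν i) (u u' : State G) : 0 ≤ activityRate G ν u u' :=
  add_nonneg (Finset.sum_nonneg fun i _ => by split_ifs; exacts [(hν i).le, le_rfl])
    (Finset.sum_nonneg fun i _ => by split_ifs <;> norm_num)

theorem activityRate_insert {u u' : State G} {i : V} (hi : i ∉ u.1) (h : u'.1 = insert i u.1) :
    activityRate G ν u u' = ν i := by
  have h1 : ∀ j, (j ∉ u.1 ∧ u'.1 = insert j u.1) ↔ j = i := by
    refine fun j => ⟨fun ⟨hj, hj'⟩ => ?_, by rintro rfl; exact ⟨hi, h⟩⟩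
    have : j ∈ insert i u.1 := by rw [← h, hj']; exact Finset.mem_insert_self _ _
    exact (Finset.mem_insert.1 this).resolve_right hj
  have h2 : ∀ j, ¬ (j ∈ u.1 ∧ u'.1 = u.1.erase j) := by
    rintro j ⟨hj, hj'⟩
    have : j ∈ u'.1 := by rw [h]; exact Finset.mem_insert_of_mem hj
    simp [hj'] at this
  simp [activityRate, h1, h2]

theorem activityRate_erase {u u' : State G} {i : V} (hi : i ∈ u.1) (h : u'.1 = u.1.erase i) :
    activityRate G ν u u' = 1 := by
  have h1 : ∀ j, (j ∈ u.1 ∧ u'.1 = u.1.erase j) ↔ j = i := by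
    refine fun j => ⟨fun ⟨hj, hj'⟩ => ?_, by rintro rfl; exact ⟨hi, h⟩⟩
    by_contra hne
    have : j ∈ u'.1 := by rw [h]; exact Finset.mem_erase.2 ⟨hne, hj⟩
    simp [hj'] at this
  have h2 : ∀ j, ¬ (j ∉ u.1 ∧ u'.1 = insert j u.1) := by
    rintro j ⟨hj, hj'⟩
    have : j ∈ u'.1 := by rw [hj']; exact Finset.mem_insert_self _ _
    rw [h] at this
    exact hj (Finset.mem_of_mem_erase this)
  simp [activityRate, h1, h2]

theorem exists_of_activityRate_ne_zero {u u' : State G} (h : activityRate G ν u u' ≠ 0) :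
    (∃ i, i ∉ u.1 ∧ u'.1 = insert i u.1) ∨ ∃ i, i ∈ u.1 ∧ u'.1 = u.1.erase i := by
  by_contra! hne
  refine h ?_
  rw [activityRate, Finset.sum_eq_zero, Finset.sum_eq_zero, add_zero]
  · exact fun i _ => if_neg fun hi => hne.2 i hi.1 hi.2
  · exact fun i _ => if_neg fun hi => hne.1 i hi.1 hi.2

theorem activityRate_self (u : State G) : activityRate G ν u u = 0 := by
  by_contra h
  rcases exists_of_activityRate_ne_zero h with ⟨i, hi, h⟩ | ⟨i, hi, h⟩
  · exact hi (by rw [h]; exact Finset.mem_insert_self _ _)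
  · rw [h] at hi; simp at hi

theorem stateWeight_mul_activityRate (u u' : State G) :
    stateWeight ν u * activityRate G ν u u' = stateWeight ν u' * activityRate G ν u' u := by
  by_cases h : ∃ i, i ∉ u.1 ∧ u'.1 = insert i u.1
  · obtain ⟨i, hi, h⟩ := h
    obtain ⟨hi', h'⟩ := insert_iff_erase.1 ⟨hi, h⟩
    rw [activityRate_insert hi h, activityRate_erase hi' h', stateWeight_insert hi h]
    ring
  by_cases h2 : ∃ i, i ∈ u.1 ∧ u'.1 = u.1.erase i
  · obtain ⟨i, hi, h2⟩ := h2
    obtain ⟨hi', h'⟩ := insert_iff_erase.2 ⟨hi, h2⟩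
    rw [activityRate_insert hi' h', activityRate_erase hi h2, stateWeight_insert hi' h']
    ring
  have e1 : activityRate G ν u u' = 0 := by
    by_contra hne
    exact (exists_of_activityRate_ne_zero hne).elim h h2
  have e2 : activityRate G ν u' u = 0 := by
    by_contra hne
    rcases exists_of_activityRate_ne_zero hne with ⟨i, hi⟩ | ⟨i, hi⟩
    · exact h2 ⟨i, insert_iff_erase.1 hi⟩
    · exact h ⟨i, insert_iff_erase.2 hi⟩
  rw [e1, e2, mul_zero, mul_zero]

/-- The partition function. -/
def partitionFun (G : SimpleGraph V) (ν : V → ℝ) : ℝ := ∑ u : State G, stateWeight ν u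

theorem IsStationary.eq_stateWeight_div (hν : ∀ i, 0 < ν i) {π : State G → ℝ}
    (hπ : IsStationary (activityRate G ν) π) (u : State G) :
    π u = stateWeight ν u / partitionFun G ν := by
  -- The density is constant along transitions, and every state reaches the empty one by successive
  -- de-activations.
  have hconst : ∀ n, ∀ u : State G, u.1.card = n →
      π u / stateWeight ν u = π (emptyState G) := by
    intro n
    induction n with
    | zero =>
      intro u hu
      have : u = emptyState G := Subtype.ext (Finset.card_eq_zero.1 hu)
      rw [this]
      simp [stateWeight, emptyState]
    | succ n ih =>
      intro u hu
      obtain ⟨i, hi⟩ : u.1.Nonempty := Finset.card_pos.1 (by omega)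
      rw [← ih (eraseState u i) (by simp [eraseState, Finset.card_erase_of_mem hi, hu])]
      refine IsStationary.div_eq_div (activityRate_nonneg hν) (stateWeight_pos hν)
        stateWeight_mul_activityRate hπ ?_
      rw [activityRate_erase hi rfl]
      norm_num
  have h : ∀ u, π u = stateWeight ν u * π (emptyState G) := fun u => by
    rw [← hconst _ u rfl]; field_simp [(stateWeight_pos hν u).ne']
  have h1 : partitionFun G ν * π (emptyState G) = 1 := by
    rw [partitionFun, Finset.sum_mul, ← hπ.2.1]
    exact Finset.sum_congr rfl fun u _ => (h u).symm
  rw [h u, eq_div_iff (left_ne_zero_of_mul_eq_one h1), mul_assoc, mul_comm (π _), h1, mul_one]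

/-! ### Throughput: stability bounds the activity of each node from below. -/

section Queue

variable {lam : V → ℝ}

theorem ofReal_ite_zero (p : Prop) [Decidable p] (a : ℝ) :
    ENNReal.ofReal (if p then a else 0) = if p then ENNReal.ofReal a else 0 := by
  split_ifs <;> simp

theorem ofReal_activityRate (hν : ∀ i, 0 < ν i) (u u' : State G) :
    ENNReal.ofReal (activityRate G ν u u') =
      (∑ i, if i ∉ u.1 ∧ u'.1 = insert i u.1 then ENNReal.ofReal (ν i) else 0) +
        ∑ i, if i ∈ u.1 ∧ u'.1 = u.1.erase i then 1 else 0 := by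
  have h1 : ∀ i ∈ Finset.univ, (0 : ℝ) ≤ if i ∉ u.1 ∧ u'.1 = insert i u.1 then ν i else 0 :=
    fun i _ => by split_ifs; exacts [(hν i).le, le_rfl]
  have h2 : ∀ i ∈ Finset.univ, (0 : ℝ) ≤ if i ∈ u.1 ∧ u'.1 = u.1.erase i then 1 else 0 :=
    fun i _ => by split_ifs <;> norm_num
  rw [activityRate, ENNReal.ofReal_add (Finset.sum_nonneg h1) (Finset.sum_nonneg h2),
    ENNReal.ofReal_sum_of_nonneg h1, ENNReal.ofReal_sum_of_nonneg h2]
  simp only [ofReal_ite_zero, ENNReal.ofReal_one]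

theorem ofReal_queueRate (hlam : ∀ i, 0 < lam i) (hν : ∀ i, 0 < ν i)
    (s s' : State G × (V → ℕ)) :
    ENNReal.ofReal (queueRate G lam ν s s') =
      (∑ i, if s'.1 = s.1 ∧ s'.2 = s.2 + Pi.single i 1 then ENNReal.ofReal (lam i) else 0) +
      (∑ i, if i ∉ s.1.1 ∧ s'.1.1 = insert i s.1.1 ∧ s'.2 = s.2 then ENNReal.ofReal (ν i) else 0) +
      ∑ i, if i ∈ s.1.1 ∧ s'.1.1 = s.1.1.erase i ∧ s'.2 = s.2 - Pi.single i 1 then 1 else 0 := by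
  have h0 : ∀ i ∈ Finset.univ,
      (0 : ℝ) ≤ if s'.1 = s.1 ∧ s'.2 = s.2 + Pi.single i 1 then lam i else 0 :=
    fun i _ => by split_ifs; exacts [(hlam i).le, le_rfl]
  have h1 : ∀ i ∈ Finset.univ,
      (0 : ℝ) ≤ if i ∉ s.1.1 ∧ s'.1.1 = insert i s.1.1 ∧ s'.2 = s.2 then ν i else 0 :=
    fun i _ => by split_ifs; exacts [(hν i).le, le_rfl]
  have h2 : ∀ i ∈ Finset.univ, (0 : ℝ) ≤
      if i ∈ s.1.1 ∧ s'.1.1 = s.1.1.erase i ∧ s'.2 = s.2 - Pi.single i 1 then 1 else 0 :=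
    fun i _ => by split_ifs <;> norm_num
  rw [queueRate, ENNReal.ofReal_add (add_nonneg (Finset.sum_nonneg h0) (Finset.sum_nonneg h1))
    (Finset.sum_nonneg h2), ENNReal.ofReal_add (Finset.sum_nonneg h0) (Finset.sum_nonneg h1),
    ENNReal.ofReal_sum_of_nonneg h0, ENNReal.ofReal_sum_of_nonneg h1,
    ENNReal.ofReal_sum_of_nonneg h2]
  simp only [ofReal_ite_zero, ENNReal.ofReal_one]

theorem tsum_ite_and_mul {A B : Type*} [Fintype A] (p : A → Prop) [DecidablePred p] (b : B)
    [∀ y : A × B, Decidable (p y.1 ∧ y.2 = b)] (r : ℝ≥0∞)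
    (g : A × B → ℝ≥0∞) :
    ∑' y : A × B, (if p y.1 ∧ y.2 = b then r else 0) * g y =
      ∑ a, (if p a then r else 0) * g (a, b) := by
  rw [ENNReal.tsum_prod', tsum_fintype]
  refine Finset.sum_congr rfl fun a _ => ?_
  rw [tsum_eq_single b fun b' hb' => by simp [hb']]
  simp

theorem tsum_queueRate_mul (hlam : ∀ i, 0 < lam i) (hν : ∀ i, 0 < ν i) (u : State G) (n : V → ℕ)
    (g : State G × (V → ℕ) → ℝ≥0∞) :
    ∑' y, ENNReal.ofReal (queueRate G lam ν (u, n) y) * g y =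
      ∑ i, ENNReal.ofReal (lam i) * g (u, n + Pi.single i 1) +
      (∑ i, ∑ u' : State G, (if i ∉ u.1 ∧ u'.1 = insert i u.1 then ENNReal.ofReal (ν i) else 0) *
        g (u', n)) +
      ∑ i, ∑ u' : State G, (if i ∈ u.1 ∧ u'.1 = u.1.erase i then 1 else 0) *
        g (u', n - Pi.single i 1) := by
  simp only [ofReal_queueRate hlam hν, add_mul, Finset.sum_mul]
  rw [ENNReal.tsum_add, ENNReal.tsum_add, Summable.tsum_finsetSum (fun _ _ => ENNReal.summable),
    Summable.tsum_finsetSum (fun _ _ => ENNReal.summable),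
    Summable.tsum_finsetSum (fun _ _ => ENNReal.summable)]
  congr 1
  · congr 1
    · refine Finset.sum_congr rfl fun i _ => ?_
      rw [tsum_ite_and_mul (fun a => a = u)]
      simp
    · refine Finset.sum_congr rfl fun i _ => ?_
      simp only [← and_assoc]
      rw [tsum_ite_and_mul (fun a : State G => i ∉ u.1 ∧ a.1 = insert i u.1)]
  · refine Finset.sum_congr rfl fun i _ => ?_
    simp only [← and_assoc]
    rw [tsum_ite_and_mul (fun a : State G => i ∈ u.1 ∧ a.1 = u.1.erase i)]

/-- Arrivals leave the activity state unchanged and contribute only a constant rate; this is why the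
activity marginal is itself invariant. -/
theorem tsum_queueRate_mul_fst (hlam : ∀ i, 0 < lam i) (hν : ∀ i, 0 < ν i) (u : State G)
    (n : V → ℕ) (g : State G → ℝ≥0∞) :
    ∑' y, ENNReal.ofReal (queueRate G lam ν (u, n) y) * g y.1 =
      (∑ i, ENNReal.ofReal (lam i)) * g u +
        ∑ u', ENNReal.ofReal (activityRate G ν u u') * g u' := by
  rw [tsum_queueRate_mul hlam hν u n (fun y => g y.1)]
  simp only [ofReal_activityRate hν, add_mul, Finset.sum_add_distrib, Finset.sum_mul]
  rw [add_assoc]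
  congr 2 <;> exact Finset.sum_comm

theorem exitRate_queueRate (hlam : ∀ i, 0 < lam i) (hν : ∀ i, 0 < ν i) (u : State G) (n : V → ℕ) :
    exitRate (queueRate G lam ν) (u, n) =
      (∑ i, ENNReal.ofReal (lam i)) + ∑ u', ENNReal.ofReal (activityRate G ν u u') := by
  simpa [exitRate] using tsum_queueRate_mul_fst hlam hν u n (fun _ => 1)

/-- One-step change of the truncated queue length of node `i`. -/
theorem tsum_queueRate_mul_min (hlam : ∀ i, 0 < lam i) (hν : ∀ i, 0 < ν i) (i : V) (B : ℕ)
    (x : State G × (V → ℕ)) :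
    (∑' y, ENNReal.ofReal (queueRate G lam ν x y) * (min (x.2 i) B : ℕ)) +
        ENNReal.ofReal (lam i) * (if x.2 i < B then 1 else 0) ≤
      (∑' y, ENNReal.ofReal (queueRate G lam ν x y) * (min (y.2 i) B : ℕ)) +
        if i ∈ x.1.1 then 1 else 0 := by
  obtain ⟨u, n⟩ := x
  rw [tsum_queueRate_mul hlam hν u n (fun _ => ((min (n i) B : ℕ) : ℝ≥0∞)),
    tsum_queueRate_mul hlam hν u n (fun y => ((min (y.2 i) B : ℕ) : ℝ≥0∞))]
  simp only
  -- Only an arrival at `i` matters, and it raises the truncated length by one exactly when the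
  -- length is below `B`.
  have harr : (∑ j, ENNReal.ofReal (lam j) * ((min (n i) B : ℕ) : ℝ≥0∞)) +
      ENNReal.ofReal (lam i) * (if n i < B then 1 else 0) ≤
      ∑ j, ENNReal.ofReal (lam j) *
        ((min ((n + Pi.single j 1 : V → ℕ) i) B : ℕ) : ℝ≥0∞) := by
    have : ENNReal.ofReal (lam i) * (if n i < B then 1 else 0) =
        ∑ j, ENNReal.ofReal (lam j) * (if j = i ∧ n i < B then 1 else 0) := by
      rw [Finset.sum_eq_single i]
      · simp
      · intro j _ hj; simp [hj]
      · simp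
    rw [this, ← Finset.sum_add_distrib]
    refine Finset.sum_le_sum fun j _ => ?_
    rw [← mul_add]
    gcongr
    by_cases hj : j = i
    · subst hj
      by_cases hB : n j < B
      · simp only [hB, and_self, if_true, Pi.add_apply, Pi.single_eq_same]
        rw [min_eq_left hB.le, min_eq_left (by omega)]
        push_cast
        exact le_rfl
      · simp only [hB, and_false, if_false, add_zero]
        gcongr
        simp
    · simp [hj, Ne.symm hj]
  -- A completion at `i` lowers the truncated length by at most one, so departures cost at most the
  -- indicator that `i` is active.
  have hdep : (∑ j, ∑ u' : State G, (if j ∈ u.1 ∧ u'.1 = u.1.erase j then (1 : ℝ≥0∞) else 0) *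
      ((min (n i) B : ℕ) : ℝ≥0∞)) ≤
      (∑ j, ∑ u' : State G, (if j ∈ u.1 ∧ u'.1 = u.1.erase j then 1 else 0) *
        ((min ((n - Pi.single j 1 : V → ℕ) i) B : ℕ) : ℝ≥0∞)) + if i ∈ u.1 then 1 else 0 := by
    have hone : (∑ j, ∑ u' : State G, if j = i ∧ j ∈ u.1 ∧ u' = eraseState u j
        then (1 : ℝ≥0∞) else 0) = if i ∈ u.1 then 1 else 0 := by
      rw [Finset.sum_eq_single i]
      · by_cases hi : i ∈ u.1 <;> simp [hi]
      · intro j _ hj; simp [hj]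
      · simp
    rw [← hone, ← Finset.sum_add_distrib]
    refine Finset.sum_le_sum fun j _ => ?_
    rw [← Finset.sum_add_distrib]
    refine Finset.sum_le_sum fun u' _ => ?_
    by_cases h : j ∈ u.1 ∧ u'.1 = u.1.erase j
    · have hu' : u' = eraseState u j := Subtype.ext h.2
      rw [if_pos h, one_mul, one_mul]
      by_cases hj : j = i
      · subst hj
        rw [if_pos ⟨rfl, h.1, hu'⟩]
        simp only [Pi.sub_apply, Pi.single_eq_same]
        norm_cast
        omega
      · simp [hj, Ne.symm hj]
    · rw [if_neg h, zero_mul]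
      exact zero_le
  have hadd : ∀ a l a' b d d' t : ℝ≥0∞, a + l ≤ a' → d ≤ d' + t →
      a + b + d + l ≤ a' + b + d' + t := fun a l a' b d d' t h1 h2 => by
    calc a + b + d + l = a + l + b + d := by ring
      _ ≤ a' + b + (d' + t) := add_le_add (add_le_add h1 le_rfl) h2
      _ = _ := by ring
  exact hadd _ _ _ _ _ _ _ harr hdep

/-- In a stable network, every node is active a sufficient fraction of time. -/
theorem Stable.exists_isStationary [Nonempty V] (hlam : ∀ i, 0 < lam i) (hν : ∀ i, 0 < ν i)
    (hst : Stable G lam ν) :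
    ∃ π : State G → ℝ, IsStationary (activityRate G ν) π ∧
      ∀ i, lam i ≤ ∑ u, π u * (if i ∈ u.1 then 1 else 0) := by
  set Λ : ℝ≥0∞ := ∑ i, ENNReal.ofReal (lam i) with hΛ
  have hΛtop : Λ ≠ ∞ := ENNReal.sum_ne_top.2 fun i _ => ENNReal.ofReal_ne_top
  have hΛ0 : Λ ≠ 0 := by
    obtain ⟨i⟩ := ‹Nonempty V›
    intro h
    have := (Finset.sum_eq_zero_iff.1 h) i (Finset.mem_univ i)
    exact absurd this (ENNReal.ofReal_pos.2 (hlam i)).ne'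
  set C : ℝ≥0∞ := Λ + ∑ u : State G, ∑ u', ENNReal.ofReal (activityRate G ν u u') with hCdef
  have hC : C ≠ ∞ := ENNReal.add_ne_top.2 ⟨hΛtop, ENNReal.sum_ne_top.2 fun u _ =>
    ENNReal.sum_ne_top.2 fun u' _ => ENNReal.ofReal_ne_top⟩
  have hle : ∀ y, exitRate (queueRate G lam ν) y ≤ C := by
    rintro ⟨u, n⟩
    rw [exitRate_queueRate hlam hν]
    refine add_le_add le_rfl ?_
    exact Finset.single_le_sum (f := fun u : State G =>
      ∑ u', ENNReal.ofReal (activityRate G ν u u')) (fun _ _ => zero_le) (Finset.mem_univ u)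
  have h0 : ∀ y, exitRate (queueRate G lam ν) y ≠ 0 := by
    rintro ⟨u, n⟩
    rw [exitRate_queueRate hlam hν]
    exact fun h => hΛ0 (add_eq_zero.1 h).1
  obtain ⟨μ, hfin, hpos, hbal⟩ := exists_invariant_measure hC hle h0 (hst (emptyState G, 0))
  set T : ℝ≥0∞ := ∑' y, μ y with hT
  have hT0 : T ≠ 0 := fun h => hpos (ENNReal.tsum_eq_zero.1 h _)
  have hTr : 0 < T.toReal := ENNReal.toReal_pos hT0 hfin
  set m : State G → ℝ≥0∞ := fun u => ∑' n, μ (u, n) with hm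
  have hmT : ∑ u, m u = T := by rw [hT, ENNReal.tsum_prod', tsum_fintype]
  have hmtop : ∀ u, m u ≠ ∞ := fun u => ne_top_of_le_ne_top hfin (by
    change _ ≤ T
    rw [← hmT]; exact Finset.single_le_sum (fun _ _ => zero_le) (Finset.mem_univ u))
  have hmarg : ∀ f : State G → ℝ≥0∞, ∑' x, μ x * f x.1 = ∑ u, m u * f u := by
    intro f
    rw [ENNReal.tsum_prod', tsum_fintype]
    exact Finset.sum_congr rfl fun u _ => by dsimp only; rw [ENNReal.tsum_mul_right]
  have hmbal : ∀ v, ∑ u, m u * ENNReal.ofReal (activityRate G ν u v) =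
      m v * ∑ u, ENNReal.ofReal (activityRate G ν v u) := by
    intro v
    -- Testing balance against the indicator of `v` and cancelling the finite arrival terms gives
    -- balance for the marginal `m`.
    have h := tsum_mul_exitRate_mul hbal (fun x => if x.1 = v then 1 else 0)
    have hL : ∀ x : State G × (V → ℕ), ∑' y, ENNReal.ofReal (queueRate G lam ν x y) *
        (if x.1 = v then 1 else 0) =
        (fun u => (Λ + ∑ u', ENNReal.ofReal (activityRate G ν u u')) *
          (if u = v then 1 else 0)) x.1 := by
      rintro ⟨u, n⟩
      rw [ENNReal.tsum_mul_right]
      congr 1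
      exact exitRate_queueRate hlam hν u n
    have hR : ∀ x : State G × (V → ℕ), ∑' y, ENNReal.ofReal (queueRate G lam ν x y) *
        (if y.1 = v then 1 else 0) =
        (fun u => Λ * (if u = v then 1 else 0) + ENNReal.ofReal (activityRate G ν u v)) x.1 := by
      rintro ⟨u, n⟩
      rw [tsum_queueRate_mul_fst hlam hν u n (fun u => if u = v then 1 else 0)]
      simp [hΛ]
    simp only [hL, hR] at h
    rw [hmarg (fun u => (Λ + ∑ u', ENNReal.ofReal (activityRate G ν u u')) *
          (if u = v then 1 else 0)),
      hmarg (fun u => Λ * (if u = v then 1 else 0) + ENNReal.ofReal (activityRate G ν u v))] at h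
    simp only [mul_add, Finset.sum_add_distrib, mul_ite, mul_one, mul_zero,
      Finset.sum_ite_eq', Finset.mem_univ, if_true] at h
    exact ((ENNReal.add_right_inj (ENNReal.mul_ne_top (hmtop v) hΛtop)).1 h).symm
  have hthr : ∀ i, ENNReal.ofReal (lam i) * T ≤ ∑ u, m u * (if i ∈ u.1 then 1 else 0) := by
    intro i
    have hB : ∀ B : ℕ, ENNReal.ofReal (lam i) * ∑' x, μ x * (if x.2 i < B then 1 else 0) ≤
        ∑ u, m u * (if i ∈ u.1 then 1 else 0) := by
      intro B
      have h := tsum_mul_exitRate_mul hbal (fun x => ((min (x.2 i) B : ℕ) : ℝ≥0∞))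
      -- Truncation at `B` makes the mean drift terms finite, so they cancel; the untruncated mean
      -- queue length may be infinite.
      have hfinA : ∑' x, μ x * ∑' y, ENNReal.ofReal (queueRate G lam ν x y) *
          ((min (x.2 i) B : ℕ) : ℝ≥0∞) ≠ ∞ := by
        refine ne_top_of_le_ne_top (ENNReal.mul_ne_top hfin
          (ENNReal.mul_ne_top hC (ENNReal.natCast_ne_top B))) ?_
        rw [← ENNReal.tsum_mul_right]
        refine ENNReal.tsum_le_tsum fun x => ?_
        rw [ENNReal.tsum_mul_right]
        gcongr
        · exact hle x
        · exact min_le_right _ _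
      have hsum := ENNReal.tsum_le_tsum fun x : State G × (V → ℕ) =>
        mul_le_mul_right (tsum_queueRate_mul_min hlam hν i B x) (μ x)
      simp only [mul_add] at hsum
      rw [ENNReal.tsum_add, ENNReal.tsum_add, ← h, ENNReal.add_le_add_iff_left hfinA] at hsum
      rw [← hmarg (fun u => if i ∈ u.1 then 1 else 0), ← ENNReal.tsum_mul_left]
      refine le_trans (le_of_eq (tsum_congr fun x => ?_)) hsum
      ring
    -- The limit B → ∞: each finite partial sum of μ involves only queue lengths below some `B`.
    rw [hT, ← ENNReal.tsum_mul_left, ENNReal.tsum_eq_iSup_sum]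
    refine iSup_le fun F => le_trans ?_ (hB (F.sup (fun x => x.2 i) + 1))
    rw [← Finset.mul_sum]
    gcongr
    refine le_trans (Finset.sum_le_sum fun x hx => ?_) (ENNReal.sum_le_tsum F)
    have : x.2 i < F.sup (fun x => x.2 i) + 1 :=
      Nat.lt_succ_of_le (Finset.le_sup (f := fun x : State G × (V → ℕ) => x.2 i) hx)
    simp [this]
  refine ⟨fun u => (m u).toReal / T.toReal, isStationary_of_balance activityRate_self
    (fun u => by positivity) ?_ fun v => ?_, fun i => ?_⟩
  · rw [← Finset.sum_div, ← ENNReal.toReal_sum fun u _ => hmtop u, hmT, div_self hTr.ne']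
  · have h := congrArg ENNReal.toReal (hmbal v)
    rw [ENNReal.toReal_sum fun u _ => ENNReal.mul_ne_top (hmtop u) ENNReal.ofReal_ne_top,
      ENNReal.toReal_mul, ENNReal.toReal_sum fun u _ => ENNReal.ofReal_ne_top] at h
    simp only [ENNReal.toReal_mul, ENNReal.toReal_ofReal (activityRate_nonneg hν _ _)] at h
    rw [div_mul_eq_mul_div, ← h, Finset.sum_div]
    exact Finset.sum_congr rfl fun u _ => by ring
  · have hne : ∀ u ∈ Finset.univ, m u * (if i ∈ u.1 then 1 else 0) ≠ ∞ := fun u _ =>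
      ENNReal.mul_ne_top (hmtop u) (by split_ifs <;> simp)
    have h := ENNReal.toReal_mono (ENNReal.sum_ne_top.2 hne) (hthr i)
    rw [ENNReal.toReal_sum hne, ENNReal.toReal_mul, ENNReal.toReal_ofReal (hlam i).le] at h
    simp only [div_mul_eq_mul_div, ← Finset.sum_div]
    rw [le_div_iff₀ hTr]
    refine h.trans (le_of_eq (Finset.sum_congr rfl fun u _ => ?_))
    rw [ENNReal.toReal_mul]
    split_ifs <;> simp

/-- The product form makes the stationary law unique, so the given π is the one produced by the
joint process. -/
theorem Stable.le_sum [Nonempty V] (hlam : ∀ i, 0 < lam i) (hν : ∀ i, 0 < ν i)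
    (hst : Stable G lam ν) {π : State G → ℝ} (hπ : IsStationary (activityRate G ν) π) (i : V) :
    lam i ≤ ∑ u, π u * (if i ∈ u.1 then 1 else 0) := by
  obtain ⟨σ, hσ, h⟩ := hst.exists_isStationary hlam hν
  have : π = σ := funext fun u => by
    rw [hπ.eq_stateWeight_div hν, hσ.eq_stateWeight_div hν]
  rw [this]; exact h i

end Queue

end RandomAccessNetwork

/-! ### The potential H, path connectivity and the sets S_l(T). -/

section Bottlenecks

variable {V : Type*} [Fintype V] {G : SimpleGraph V} {ν : V → ℝ} {K : ℕ} {c : G.Coloring (Fin K)}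

section Components

theorem mem_component {k : Fin K} {i : V} : i ∈ component c k ↔ c i = k := by
  simp [component]

/-- A clique of size `K` meets every component. -/
theorem compSize_pos_of_isNClique {C : Finset V} (hC : G.IsNClique K C) (c : G.Coloring (Fin K))
    (k : Fin K) : 0 < compSize c k := by
  have hinj : Set.InjOn c (C : Set V) := fun i hi j hj h => by
    by_contra hne
    exact c.valid (hC.isClique hi hj hne) h
  have : C.image c = Finset.univ := by
    rw [← Finset.card_eq_iff_eq_univ, Finset.card_image_of_injOn hinj, hC.card_eq, Fintype.card_fin]
  obtain ⟨i, -, hi⟩ := Finset.mem_image.1 (this ▸ Finset.mem_univ k)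
  exact Finset.card_pos.2 ⟨i, mem_component.2 hi⟩

theorem compSize_le_maxCompSize (k : Fin K) : compSize c k ≤ maxCompSize c :=
  Finset.le_sup (Finset.mem_univ k)

theorem maxCompSize_le_card : maxCompSize c ≤ Fintype.card V :=
  Finset.sup_le fun _ _ => Finset.card_le_univ _

theorem compSize_color_pos (i : V) : 0 < compSize c (c i) :=
  Finset.card_pos.2 ⟨i, mem_component.2 rfl⟩

theorem H_eq_sum (u : State G) : H c u = ∑ i ∈ u.1, 1 / (compSize c (c i) : ℝ) := by
  have : H c u = ∑ k, ∑ i with c i = k, (if i ∈ u.1 then 1 else 0) / (compSize c (c i) : ℝ) := by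
    refine Finset.sum_congr rfl fun k _ => Finset.sum_congr rfl fun i hi => ?_
    rw [(Finset.mem_filter.1 hi).2]
  rw [this, Finset.sum_fiberwise]
  simp only [ite_div, zero_div]
  rw [Finset.sum_ite_mem, Finset.univ_inter]

theorem H_nonneg (u : State G) : 0 ≤ H c u := by
  rw [H_eq_sum]; exact Finset.sum_nonneg fun _ _ => by positivity

theorem H_le_of_subset {u u' : State G} (h : u.1 ⊆ u'.1) : H c u ≤ H c u' := by
  rw [H_eq_sum, H_eq_sum]
  exact Finset.sum_le_sum_of_subset_of_nonneg h fun _ _ _ => by positivity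

theorem H_emptyState : H c (emptyState G) = 0 := by
  rw [H_eq_sum]; simp [emptyState]

theorem H_insert {u u' : State G} {i : V} (hi : i ∉ u.1) (h : u'.1 = insert i u.1) :
    H c u' = H c u + 1 / (compSize c (c i) : ℝ) := by
  rw [H_eq_sum, H_eq_sum, h, Finset.sum_insert hi, add_comm]

theorem H_fullState {k : Fin K} (hk : 0 < compSize c k) : H c (fullState c k) = 1 := by
  rw [H_eq_sum]
  have : ∀ i ∈ (fullState c k).1, 1 / (compSize c (c i) : ℝ) = 1 / compSize c k := fun i hi => by
    rw [mem_component.1 hi]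
  rw [Finset.sum_congr rfl this, Finset.sum_const, nsmul_eq_mul]
  change (compSize c k : ℝ) * _ = 1
  field_simp

/-- Each active node adds at least 1/M to H. This bounds the number of exits and later makes the sum
over states geometric. -/
theorem card_le_mul_H (u : State G) : (u.1.card : ℝ) ≤ maxCompSize c * H c u := by
  rw [H_eq_sum, Finset.mul_sum, Finset.card_eq_sum_ones]
  push_cast
  refine Finset.sum_le_sum fun i _ => ?_
  have h1 : (0 : ℝ) < compSize c (c i) := by exact_mod_cast compSize_color_pos i
  rw [mul_one_div, le_div_iff₀ h1, one_mul]
  exact_mod_cast compSize_le_maxCompSize (c i)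

end Components

section Paths

theorem activityRate_pos_symm (hν : ∀ i, 0 < ν i) {u u' : State G}
    (h : 0 < activityRate G ν u u') : 0 < activityRate G ν u' u := by
  have h1 := stateWeight_mul_activityRate (ν := ν) u u'
  have h2 := mul_pos (stateWeight_pos hν u) h
  rw [h1] at h2
  exact pos_of_mul_pos_right h2 (stateWeight_pos hν u').le

theorem IsPath.reverse (hν : ∀ i, 0 < ν i) {u v : State G} {l : ℕ} {p : Fin (l + 1) → State G}
    (h : IsPath ν u v p) : IsPath ν v u (p ∘ Fin.rev) := by
  refine ⟨by simpa using h.2.1, by simpa using h.1, fun j => ?_⟩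
  have := activityRate_pos_symm hν (h.2.2 j.rev)
  simpa [Function.comp, Fin.rev_castSucc, Fin.rev_succ] using this

theorem IsPath.snoc {u v v' : State G} {l : ℕ} {p : Fin (l + 1) → State G}
    (h : IsPath ν u v p) (hv : 0 < activityRate G ν v v') :
    IsPath ν u v' (Fin.snoc p v' : Fin (l + 1 + 1) → State G) := by
  refine ⟨?_, by simp, fun j => ?_⟩
  · rw [← h.1]
    exact Fin.snoc_castSucc (α := fun _ => State G) v' p 0
  · induction j using Fin.lastCases with
    | last =>
      rw [Fin.succ_last, Fin.snoc_last, Fin.snoc_castSucc, h.2.1]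
      exact hv
    | cast j =>
      rw [← Fin.castSucc_succ, Fin.snoc_castSucc, Fin.snoc_castSucc]
      exact h.2.2 j

theorem pathMax_self (u : State G) : pathMax c ν u u = ⊤ := if_pos rfl

theorem pathMax_of_ne {u v : State G} (h : u ≠ v) : pathMax c ν u v =
    ⨆ (l : ℕ) (p : Fin (l + 1) → State G) (_ : IsPath ν u v p), ⨅ j, (H c (p j) : EReal) :=
  if_neg h

theorem pathMax_le (hν : ∀ i, 0 < ν i) (u v : State G) : pathMax c ν u v ≤ pathMax c ν v u := by
  by_cases h : u = v
  · rw [h]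
  rw [pathMax_of_ne h, pathMax_of_ne (Ne.symm h)]
  refine iSup_le fun l => iSup_le fun p => iSup_le fun hp => ?_
  refine le_trans (le_of_eq ?_) (le_iSup_of_le l (le_iSup_of_le (p ∘ Fin.rev)
    (le_iSup_of_le (hp.reverse hν) le_rfl)))
  exact (Fin.revPerm.surjective.iInf_comp (fun j => (H c (p j) : EReal))).symm

theorem pathMax_comm (hν : ∀ i, 0 < ν i) (u v : State G) : pathMax c ν u v = pathMax c ν v u :=
  le_antisymm (pathMax_le hν u v) (pathMax_le hν v u)

theorem pathMax_le_H {u v : State G} (h : u ≠ v) : pathMax c ν u v ≤ H c v := by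
  rw [pathMax_of_ne h]
  refine iSup_le fun l => iSup_le fun p => iSup_le fun hp => ?_
  exact (iInf_le _ (Fin.last l)).trans (by rw [hp.2.1])

/-- A path is extended by one step. The case u = v must be excluded: there `pathMax` is `⊤`,
although a path starting at `u` is still limited by H(u). -/
theorem min_le_pathMax {u v v' : State G} (h : u ≠ v) (hv : 0 < activityRate G ν v v') :
    min (pathMax c ν u v) (H c v') ≤ pathMax c ν u v' := by
  by_cases h' : u = v'
  · rw [h', pathMax_self]; exact le_top
  rw [pathMax_of_ne h, pathMax_of_ne h', iSup_inf_eq]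
  refine iSup_le fun l => ?_
  rw [iSup_inf_eq]
  refine iSup_le fun p => ?_
  rw [iSup_inf_eq]
  refine iSup_le fun hp => ?_
  refine le_iSup_of_le (l + 1) (le_iSup_of_le _ (le_iSup_of_le (hp.snoc hv) ?_))
  refine le_iInf fun j => ?_
  induction j using Fin.lastCases with
  | last => rw [Fin.snoc_last]; exact min_le_right _ _
  | cast j => rw [Fin.snoc_castSucc]; exact (min_le_left _ _).trans (iInf_le _ j)

/-- Activating a node does not decrease the connectivity to a given state. -/
theorem pathMax_le_insert (hν : ∀ i, 0 < ν i) {u v v' : State G} {i : V} (h : u ≠ v) (hi : i ∉ v.1)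
    (hv : v'.1 = insert i v.1) : pathMax c ν u v ≤ pathMax c ν u v' := by
  refine le_trans (le_min le_rfl ?_) (min_le_pathMax h (v' := v') ?_)
  · refine (pathMax_le_H h).trans (EReal.coe_le_coe_iff.2 (H_le_of_subset ?_))
    rw [hv]; exact Finset.subset_insert _ _
  · rw [activityRate_insert hi hv]; exact hν i

end Paths

section Bottleneck

variable {lam w : V → ℝ} {k : Fin K} {T : Finset V}

theorem mem_bottleneckSet_of_eq {l : Fin K} (hl : l = k) {v : State G} :
    v ∈ bottleneckSet c lam ν w k T l ↔
      mOwn c lam ν w k T < ⨆ u ∈ Delta G lam w T, pathMax c ν u v := by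
  rw [bottleneckSet, if_pos hl]; rfl

theorem mem_bottleneckSet_of_ne {l : Fin K} (hl : l ≠ k) {v : State G} :
    v ∈ bottleneckSet c lam ν w k T l ↔
      mOther c lam ν w T l < pathMax c ν (fullState c l) v := by
  rw [bottleneckSet, if_neg hl]; rfl

theorem fullState_mem_Delta (hw : ∀ i, 0 ≤ w i) (hlam : ∀ i, lam i ≤ 1) (hT : T ⊆ component c k) :
    fullState c k ∈ Delta G lam w T := by
  refine Finset.sum_le_sum fun i hi => mul_le_mul_of_nonneg_left ?_ (hw i)
  have : i ∈ (fullState c k).1 := hT hi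
  rw [if_pos this]
  exact hlam i

theorem fullState_notMem_Delta (hw : ∀ i, 0 ≤ w i) (hlam : ∀ i, 0 < lam i)
    (hT : T ⊆ component c k) (hT' : ∃ i ∈ T, 0 < w i) {l : Fin K} (hl : l ≠ k) :
    fullState c l ∉ Delta G lam w T := by
  intro h
  have h1 : ∑ i ∈ T, w i * (if i ∈ (fullState c l).1 then (1 : ℝ) else 0) = 0 := by
    refine Finset.sum_eq_zero fun i hi => ?_
    have : i ∉ (fullState c l).1 := fun hi' =>
      hl ((mem_component.1 hi').symm.trans (mem_component.1 (hT hi)))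
    rw [if_neg this, mul_zero]
  have h2 : 0 < ∑ i ∈ T, w i * lam i := by
    obtain ⟨i, hi, hwi⟩ := hT'
    exact Finset.sum_pos' (fun j _ => mul_nonneg (hw j) (hlam j).le) ⟨i, hi, mul_pos hwi (hlam i)⟩
  exact absurd (h1 ▸ h : _ ≤ (0 : ℝ)) (not_le.2 h2)

theorem mOther_lt_top (hH : ∀ u : State G, H c u ≤ 1) {l : Fin K}
    (hl : fullState c l ∉ Delta G lam w T) : mOther c lam ν w T l < ⊤ := by
  refine lt_of_le_of_lt (b := ((1 : ℝ) : EReal)) (iSup₂_le fun u hu => ?_) (EReal.coe_lt_top 1)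
  refine (pathMax_le_H ?_).trans (EReal.coe_le_coe_iff.2 (hH u))
  rintro rfl
  exact hl hu

/-- A transition out of one of the sets `S_l(T)` is a de-activation. -/
theorem exists_erase_of_exit (hν : ∀ i, 0 < ν i) (hw : ∀ i, 0 ≤ w i) (hH : ∀ u : State G, H c u ≤ 1)
    (hne : ∀ k, 0 < compSize c k) {l : Fin K} {v v' : State G}
    (hv : v ∈ bottleneckSet c lam ν w k T l) (hv' : v' ∉ bottleneckSet c lam ν w k T l)
    (h : activityRate G ν v v' ≠ 0) : ∃ i, i ∈ v.1 ∧ v'.1 = v.1.erase i := by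
  rcases exists_of_activityRate_ne_zero h with ⟨i, hi, hins⟩ | h
  swap
  · exact h
  exfalso
  refine hv' ?_
  have hsub : v.1 ⊆ v'.1 := by rw [hins]; exact Finset.subset_insert _ _
  by_cases hl : l = k
  · rw [mem_bottleneckSet_of_eq hl] at hv ⊢
    obtain ⟨u, hu⟩ := lt_iSup_iff.1 hv
    obtain ⟨huD, hu⟩ := lt_iSup_iff.1 hu
    -- If `v` itself lies in Δ(T), so does the larger state `v'`, whose connectivity to itself is
    -- `⊤`.
    by_cases huv : u = v
    · have hD : v' ∈ Delta G lam w T := mem_Delta_of_subset hw (huv ▸ huD) hsub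
      refine lt_of_lt_of_le (lt_of_lt_of_le hu le_top) (le_iSup₂_of_le v' hD ?_)
      rw [pathMax_self]
    · exact lt_of_lt_of_le hu (le_iSup₂_of_le u huD (pathMax_le_insert hν huv hi hins))
  · rw [mem_bottleneckSet_of_ne hl] at hv ⊢
    -- Nothing can be activated in a full state: H is already 1 there.
    by_cases huv : fullState c l = v
    · have h1 := H_insert (c := c) hi hins
      have h2 : (0 : ℝ) < 1 / compSize c (c i) := by
        have := compSize_color_pos (c := c) i
        positivity
      have h3 := hH v'
      rw [← huv, H_fullState (hne l)] at h1
      linarith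
    · exact lt_of_lt_of_le hv (pathMax_le_insert hν huv hi hins)

/-- The sets `S_l(T)` separate two of the states with a fully active component. -/
theorem exists_fullState_mem_notMem (hK : 2 ≤ K) (hν : ∀ i, 0 < ν i) (hw : ∀ i, 0 ≤ w i)
    (hlam : ∀ i, 0 < lam i) (hlam1 : ∀ i, lam i ≤ 1) (hH : ∀ u : State G, H c u ≤ 1)
    (hT : T ⊆ component c k) (hT' : ∃ i ∈ T, 0 < w i) (l : Fin K) :
    (∃ a, fullState c a ∈ bottleneckSet c lam ν w k T l) ∧
      ∃ b, fullState c b ∉ bottleneckSet c lam ν w k T l := by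
  have hk := fullState_mem_Delta (c := c) hw hlam1 hT
  have hlt : ∀ l, l ≠ k → mOther c lam ν w T l < ⊤ := fun l hl =>
    mOther_lt_top hH (fullState_notMem_Delta hw hlam hT hT' hl)
  by_cases hl : l = k
  · have : Nontrivial (Fin K) := Fin.nontrivial_iff_two_le.2 hK
    obtain ⟨b, hb⟩ := exists_ne k
    -- S_k(T) contains v^(k), which is in Δ(T) and has connectivity `⊤` to itself, whereas m_k(T) ≤
    -- 1. It misses any other v^(b), since m_k(T) dominates m_b(T).
    refine ⟨⟨k, ?_⟩, ⟨b, ?_⟩⟩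
    · rw [mem_bottleneckSet_of_eq hl]
      refine lt_of_lt_of_le ?_ (le_iSup₂_of_le (fullState c k) hk le_rfl)
      rw [pathMax_self]
      refine lt_of_le_of_lt (b := ((1 : ℝ) : EReal)) (iSup₂_le fun l hl => iSup₂_le fun u hu => ?_)
        (EReal.coe_lt_top 1)
      refine (pathMax_le_H ?_).trans (EReal.coe_le_coe_iff.2 (hH u))
      rintro rfl
      exact fullState_notMem_Delta hw hlam hT hT' hl hu
    · rw [mem_bottleneckSet_of_eq hl]
      refine not_lt.2 (iSup₂_le fun u hu => ?_)
      rw [pathMax_comm hν]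
      exact le_iSup₂_of_le b hb (le_iSup₂_of_le u hu le_rfl)
  -- For l ≠ k, S_l(T) contains v^(l) and misses v^(k), which belongs to Δ(T) and so enters the
  -- maximum m_l(T).
  · refine ⟨⟨l, ?_⟩, ⟨k, ?_⟩⟩ <;> rw [mem_bottleneckSet_of_ne hl]
    · rw [pathMax_self]
      exact hlt l hl
    · exact not_lt.2 (le_iSup₂_of_le (fullState c k) hk le_rfl)

theorem H_le_Hl {l : Fin K} {u : State G}
    (hu : u ∈ boundary ν (bottleneckSet c lam ν w k T l)) : H c u ≤ Hl c lam ν w k T l :=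
  le_csSup (Set.toFinite _).bddAbove ⟨u, hu, rfl⟩

theorem exists_HstarMin_eq [NeZero K] (hw : ∀ i, 0 ≤ w i) (hw' : w ≠ 0) :
    ∃ (k : Fin K) (T : Finset V) (l : Fin K), T ⊆ component c k ∧ (∃ i ∈ T, 0 < w i) ∧
      HstarMin c lam ν w = Hl c lam ν w k T l := by
  set X : Set ℝ := {x | ∃ (k : Fin K) (T : Finset V),
    T ⊆ component c k ∧ (∃ i ∈ T, 0 < w i) ∧ x = Hstar c lam ν w k T} with hX
  have hfin : X.Finite := by
    refine (Set.finite_range fun p : Fin K × Finset V => Hstar c lam ν w p.1 p.2).subset ?_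
    rintro x ⟨k, T, -, -, rfl⟩
    exact ⟨(k, T), rfl⟩
  have hnon : X.Nonempty := by
    obtain ⟨i, hi⟩ := Function.ne_iff.1 hw'
    refine ⟨_, c i, {i}, ?_, ⟨i, Finset.mem_singleton_self i, lt_of_le_of_ne (hw i) (Ne.symm hi)⟩,
      rfl⟩
    rw [Finset.singleton_subset_iff]; exact mem_component.2 rfl
  obtain ⟨k, T, hT, hT', hx⟩ := hnon.csInf_mem hfin
  obtain ⟨l, hl⟩ := exists_eq_ciInf_of_finite (f := Hl c lam ν w k T)
  exact ⟨k, T, l, hT, hT', hx.trans hl.symm⟩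

end Bottleneck

end Bottlenecks

/-! ### Consequences of high load and estimates for the flow. -/

section HighLoad

variable {V : Type*} [Fintype V] {G : SimpleGraph V} {ν : V → ℝ} {K : ℕ} {c : G.Coloring (Fin K)}
  {π : State G → ℝ}

theorem partitionFun_pos (hν : ∀ i, 0 < ν i) : 0 < partitionFun G ν :=
  Finset.sum_pos (fun u _ => stateWeight_pos hν u) ⟨emptyState G, Finset.mem_univ _⟩

theorem IsStationary.pos (hν : ∀ i, 0 < ν i) (hπ : IsStationary (activityRate G ν) π)
    (u : State G) : 0 < π u := by
  rw [hπ.eq_stateWeight_div hν]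
  exact div_pos (stateWeight_pos hν u) (partitionFun_pos hν)

/-- The mean of H is the sum over components of the average activity of their nodes. -/
theorem sum_le_sum_mul_H (hne : ∀ k, 0 < compSize c k) {ρhat : Fin K → ℝ}
    (hact : ∀ i, ρhat (c i) ≤ ∑ u, π u * (if i ∈ u.1 then 1 else 0)) :
    ∑ k, ρhat k ≤ ∑ u, π u * H c u := by
  have h1 : ∑ u, π u * H c u = ∑ k, ∑ i ∈ component c k,
      (∑ u, π u * (if i ∈ u.1 then 1 else 0)) / (compSize c k : ℝ) := by
    simp only [H, Finset.mul_sum, Finset.sum_div]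
    rw [Finset.sum_comm]
    refine Finset.sum_congr rfl fun k _ => ?_
    rw [Finset.sum_comm]
    simp only [mul_div_assoc]
  rw [h1]
  refine Finset.sum_le_sum fun k _ => ?_
  have hk : (0 : ℝ) < compSize c k := by exact_mod_cast hne k
  calc ρhat k = ∑ i ∈ component c k, ρhat k / (compSize c k : ℝ) := by
        rw [Finset.sum_const, nsmul_eq_mul]
        change _ = (compSize c k : ℝ) * _
        field_simp
    _ ≤ _ := Finset.sum_le_sum fun i hi => by
        have := hact i
        rw [mem_component.1 hi] at this
        gcongr

theorem sum_mul_one_sub_H_le {q : State G → State G → ℝ} (hπ : IsStationary q π) {ρ : ℝ}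
    (h : ρ ≤ ∑ u, π u * H c u) : ∑ u, π u * (1 - H c u) ≤ 1 - ρ := by
  simp only [mul_sub, mul_one, Finset.sum_sub_distrib, hπ.2.1]
  linarith

/-- The empty state has positive probability and H = 0. Applied to r = 1 - ρ this yields ρ < 1. -/
theorem pos_of_sum_mul_one_sub_H_le (hν : ∀ i, 0 < ν i) (hπ : IsStationary (activityRate G ν) π)
    (hH : ∀ u : State G, H c u ≤ 1) {r : ℝ} (h : ∑ u, π u * (1 - H c u) ≤ r) : 0 < r := by
  refine lt_of_lt_of_le (hπ.pos hν (emptyState G)) (le_trans ?_ h)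
  have := Finset.single_le_sum (f := fun u => π u * (1 - H c u))
    (fun u _ => mul_nonneg (hπ.1 u) (by linarith [hH u])) (Finset.mem_univ (emptyState G))
  simpa [H_emptyState] using this

theorem zeta_le_one_sub_H {u : State G} (hu : u ∉ fullStates c) : zeta c ≤ 1 - H c u := by
  have := le_csSup (Set.toFinite (H c '' (fullStates c)ᶜ)).bddAbove ⟨u, hu, rfl⟩
  rw [zeta]; linarith

theorem emptyState_notMem_fullStates (hne : ∀ k, 0 < compSize c k) :
    emptyState G ∉ fullStates c := by
  rintro ⟨k, hk⟩
  have := congrArg (H c) hk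
  rw [H_fullState (hne k), H_emptyState] at this
  norm_num at this

theorem zeta_pos (hne : ∀ k, 0 < compSize c k)
    (hH : ∀ u : State G, u ∉ fullStates c → H c u < 1) : 0 < zeta c := by
  have hnon : (H c '' (fullStates c)ᶜ).Nonempty := ⟨_, _, emptyState_notMem_fullStates hne, rfl⟩
  obtain ⟨u, hu, h⟩ := hnon.csSup_mem (Set.toFinite _)
  have := hH u hu
  rw [zeta, ← h]; linarith

theorem sum_notMem_fullStates_le (hπ0 : ∀ u, 0 ≤ π u) (hH : ∀ u : State G, H c u ≤ 1) :
    (∑ u, if u ∉ fullStates c then π u else 0) * zeta c ≤ ∑ u, π u * (1 - H c u) := by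
  rw [Finset.sum_mul]
  refine Finset.sum_le_sum fun u _ => ?_
  split_ifs with h
  · rw [zero_mul]
    exact mul_nonneg (hπ0 u) (by linarith [hH u])
  · exact mul_le_mul_of_nonneg_left (zeta_le_one_sub_H h) (hπ0 u)

/-- Among the states of Ω*, only the full state of its own component has node `i` active. -/
theorem le_fullState_add (hπ0 : ∀ u, 0 ≤ π u) (i : V) :
    ∑ u, π u * (if i ∈ u.1 then 1 else 0) ≤
      π (fullState c (c i)) + ∑ u, if u ∉ fullStates c then π u else 0 := by
  have : π (fullState c (c i)) = ∑ u, if u = fullState c (c i) then π u else 0 := by simp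
  rw [this, ← Finset.sum_add_distrib]
  refine Finset.sum_le_sum fun u _ => ?_
  by_cases hi : i ∈ u.1
  · rw [if_pos hi, mul_one]
    by_cases hu : u ∈ fullStates c
    · obtain ⟨k, rfl⟩ := hu
      have : c i = k := mem_component.1 hi
      simp [this, fullStates]
    · rw [if_pos hu]
      split_ifs <;> linarith [hπ0 u]
  · rw [if_neg hi, mul_zero]
    exact add_nonneg (by split_ifs; exacts [hπ0 u, le_rfl]) (by split_ifs; exacts [le_rfl, hπ0 u])

/-- High load forces high activation rates. -/
theorem fullState_le_mul_rate (hν : ∀ i, 0 < ν i) (hνc : ∀ i j, c i = c j → ν i = ν j)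
    (hπ : IsStationary (activityRate G ν) π) (hH : ∀ u : State G, H c u ≤ 1)
    (hne : ∀ k, 0 < compSize c k) {r : ℝ} (h : ∑ u, π u * (1 - H c u) ≤ r) (i : V) :
    π (fullState c (c i)) ≤ r * ν i := by
  set v := fullState c (c i) with hv
  have hM : (0 : ℝ) < compSize c (c i) := by exact_mod_cast hne (c i)
  -- Removing one of the M_k nodes divides the probability by the common rate and lowers H by 1/M_k;
  -- summed over the nodes this is π(v)/ν_i.
  have hterm : ∀ j ∈ component c (c i), π (eraseState v j) * (1 - H c (eraseState v j)) =
      π v / ν i / compSize c (c i) := by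
    intro j hj
    obtain ⟨hj', he⟩ := insert_iff_erase.2
      (⟨hj, rfl⟩ : j ∈ v.1 ∧ (eraseState v j).1 = v.1.erase j)
    have e1 := H_insert (c := c) hj' he
    rw [mem_component.1 hj, hv, H_fullState (hne _), ← hv] at e1
    have e2 : π v = ν i * π (eraseState v j) := by
      rw [hπ.eq_stateWeight_div hν, hπ.eq_stateWeight_div hν, stateWeight_insert hj' he,
        hνc j i (mem_component.1 hj), mul_div_assoc]
    rw [e2, show 1 - H c (eraseState v j) = 1 / (compSize c (c i) : ℝ) by linarith]
    have := (hν i).ne'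
    field_simp
  have hinj : Set.InjOn (eraseState v) (component c (c i) : Set V) := by
    intro j hj j' hj' he
    by_contra hne'
    have h1 : j' ∈ (eraseState v j).1 := Finset.mem_erase.2 ⟨Ne.symm hne', hj'⟩
    rw [he] at h1
    simp [eraseState] at h1
  have h2 : ∑ j ∈ component c (c i), π (eraseState v j) * (1 - H c (eraseState v j)) ≤
      ∑ u, π u * (1 - H c u) := by
    rw [← Finset.sum_image (f := fun u => π u * (1 - H c u)) hinj]
    exact Finset.sum_le_univ_sum_of_nonneg fun u =>
      mul_nonneg (hπ.1 u) (by linarith [hH u])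
  rw [Finset.sum_congr rfl hterm, Finset.sum_const, nsmul_eq_mul] at h2
  change (compSize c (c i) : ℝ) * _ ≤ _ at h2
  rw [mul_div_cancel₀ _ hM.ne'] at h2
  exact (div_le_iff₀ (hν i)).1 (h2.trans h)

theorem pow_le_partitionFun (hν : ∀ i, 0 < ν i) {a : ℝ} (ha : 0 ≤ a) {k : Fin K}
    (h : ∀ i, c i = k → a ≤ ν i) : a ^ compSize c k ≤ partitionFun G ν := by
  refine le_trans ?_ (Finset.single_le_sum (f := stateWeight ν)
    (fun u _ => (stateWeight_pos hν u).le) (Finset.mem_univ (fullState c k)))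
  rw [compSize, ← Finset.prod_const]
  exact Finset.prod_le_prod (fun _ _ => ha) fun i hi => h i (mem_component.1 hi)

/-- States with low `H` are unlikely if the activation rates are high. -/
theorem IsStationary.le_rpow [NeZero K] (hν : ∀ i, 0 < ν i) (hνc : ∀ i j, c i = c j → ν i = ν j)
    (hπ : IsStationary (activityRate G ν) π) (hH : ∀ u : State G, H c u ≤ 1)
    {y : ℝ} (hy : 0 < y) (hyν : ∀ i, y ≤ ν i) (u : State G) :
    π u ≤ y ^ ((maxCompSize c : ℝ) * (H c u - 1)) := by
  have hZ := partitionFun_pos (G := G) hν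
  set Z := partitionFun G ν with hZdef
  -- Since ν_i^(M_k) is the weight of a full state, ν_i ≤ Z^(1/M_k); over the active nodes these
  -- exponents add up to H(u).
  have h1 : stateWeight ν u ≤ Z ^ H c u := by
    rw [H_eq_sum, Real.rpow_sum_of_pos hZ]
    refine Finset.prod_le_prod (fun i _ => (hν i).le) fun i _ => ?_
    have hM := compSize_color_pos (c := c) i
    have h2 : ν i ^ compSize c (c i) ≤ Z :=
      pow_le_partitionFun hν (hν i).le fun j hj => (hνc i j hj.symm).le
    calc ν i = (ν i ^ compSize c (c i)) ^ (1 / (compSize c (c i) : ℝ)) := by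
          rw [one_div, Real.pow_rpow_inv_natCast (hν i).le hM.ne']
      _ ≤ _ := Real.rpow_le_rpow (pow_nonneg (hν i).le _) h2 (by positivity)
  have h2 : y ^ maxCompSize c ≤ Z := by
    obtain ⟨k, -, hk⟩ := Finset.exists_mem_eq_sup Finset.univ ⟨0, Finset.mem_univ _⟩ (compSize c)
    rw [maxCompSize, hk]
    exact pow_le_partitionFun hν hy.le fun i _ => hyν i
  rw [hπ.eq_stateWeight_div hν]
  calc stateWeight ν u / Z ≤ Z ^ H c u / Z := by gcongr
    _ = Z ^ (H c u - 1) := by rw [Real.rpow_sub_one hZ.ne']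
    _ ≤ (y ^ maxCompSize c) ^ (H c u - 1) :=
        Real.rpow_le_rpow_of_nonpos (by positivity) h2 (by linarith [hH u])
    _ = _ := by rw [← Real.rpow_natCast, ← Real.rpow_mul hy.le]

theorem natCast_mul_half_pow_le (n : ℕ) : (n : ℝ) * (1 / 2) ^ n ≤ (3 / 4) ^ n := by
  have h : ∀ n : ℕ, (n : ℝ) ≤ (3 / 2) ^ n := by
    intro n
    -- The induction starts at 2 because (3/2)n ≥ n + 1 needs n ≥ 2.
    have key : ∀ m : ℕ, ((m + 2 : ℕ) : ℝ) ≤ (3 / 2) ^ (m + 2) := by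
      intro m
      induction m with
      | zero => norm_num
      | succ m ih =>
        rw [show m + 1 + 2 = (m + 2) + 1 by ring, pow_succ]
        push_cast at ih ⊢
        have : (0 : ℝ) ≤ m := Nat.cast_nonneg m
        linarith
    match n with
    | 0 => norm_num
    | 1 => norm_num
    | m + 2 => exact key m
  calc (n : ℝ) * (1 / 2) ^ n ≤ (3 / 2) ^ n * (1 / 2) ^ n := by gcongr; exact h n
    _ = _ := by rw [← mul_pow]; norm_num

/-- The contribution of one boundary state to the flow, with a = ρ_min, r = 1 - ρ, h = H(u), n the
number of active nodes. From a ≤ 1/2 and n ≤ Mh, the factor a^(Mh) is at most 2^(-n), which absorbs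
`n` and leaves (3/4)^n; the 7/8 costs at most (8/7)^N. -/
theorem card_mul_rpow_le {a r h hs : ℝ} {n M N : ℕ} (ha : 0 < a) (ha' : a ≤ 1 / 2) (hr : 0 < r)
    (hr' : r ≤ 1) (h0 : 0 ≤ h) (hhs : h ≤ hs) (hn : (n : ℝ) ≤ M * h) (hMN : M ≤ N) :
    n * (7 / 8 * a / r) ^ ((M : ℝ) * (h - 1)) ≤
      (3 / 4) ^ n * ((8 / 7) ^ N * (a ^ M)⁻¹ * r ^ ((M : ℝ) * (1 - hs))) := by
  have hM : (0 : ℝ) ≤ M := Nat.cast_nonneg M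
  have e1 : ((7 : ℝ) / 8) ^ ((M : ℝ) * (h - 1)) ≤ (8 / 7) ^ N := by
    have : ((7 : ℝ) / 8) ^ ((M : ℝ) * (h - 1)) = (8 / 7) ^ ((M : ℝ) * (1 - h)) := by
      rw [show ((8 : ℝ) / 7) = (7 / 8)⁻¹ by norm_num, Real.inv_rpow (by norm_num),
        ← Real.rpow_neg (by norm_num)]
      congr 1; ring
    rw [this, ← Real.rpow_natCast]
    refine Real.rpow_le_rpow_of_exponent_le (by norm_num) ?_
    have : (M : ℝ) ≤ N := by exact_mod_cast hMN
    nlinarith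
  have e2 : a ^ ((M : ℝ) * (h - 1)) ≤ (1 / 2) ^ n * (a ^ M)⁻¹ := by
    rw [mul_sub, mul_one, Real.rpow_sub ha, Real.rpow_natCast, div_eq_mul_inv]
    gcongr
    calc a ^ ((M : ℝ) * h) ≤ a ^ (n : ℝ) :=
          Real.rpow_le_rpow_of_exponent_ge ha (by linarith) hn
      _ = a ^ n := Real.rpow_natCast _ _
      _ ≤ _ := by gcongr
  have e3 : (r ^ ((M : ℝ) * (h - 1)))⁻¹ ≤ r ^ ((M : ℝ) * (1 - hs)) := by
    rw [← Real.rpow_neg hr.le]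
    refine Real.rpow_le_rpow_of_exponent_ge hr hr' ?_
    nlinarith
  rw [Real.div_rpow (by positivity) hr.le, Real.mul_rpow (by norm_num) ha.le, div_eq_mul_inv]
  calc (n : ℝ) * ((7 / 8) ^ ((M : ℝ) * (h - 1)) * a ^ ((M : ℝ) * (h - 1)) *
        (r ^ ((M : ℝ) * (h - 1)))⁻¹)
      ≤ n * ((8 / 7) ^ N * ((1 / 2) ^ n * (a ^ M)⁻¹) * r ^ ((M : ℝ) * (1 - hs))) := by gcongr
    _ = (n * (1 / 2) ^ n) * ((8 / 7) ^ N * (a ^ M)⁻¹ * r ^ ((M : ℝ) * (1 - hs))) := by ring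
    _ ≤ _ := by gcongr; exact natCast_mul_half_pow_le n

/-- Extending the sum to all subsets of `V` gives the binomial theorem. -/
theorem sum_pow_card_le (G : SimpleGraph V) {x : ℝ} (hx : 0 ≤ x) :
    ∑ u : State G, x ^ u.1.card ≤ (x + 1) ^ Fintype.card V := by
  rw [← Fintype.sum_pow_mul_eq_add_pow]
  simp only [one_pow, mul_one]
  refine le_trans (le_of_eq (Finset.sum_map Finset.univ
    (Function.Embedding.subtype fun s : Finset V => G.IsIndepSet (s : Set V))
    (fun s => x ^ s.card)).symm) ?_
  exact Finset.sum_le_univ_sum_of_nonneg fun s => pow_nonneg hx _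

/-- If all exits from `B` are de-activations, the flow out of `B` is carried by its boundary. -/
theorem flow_le_sum_boundary (hπ0 : ∀ u, 0 ≤ π u) {B : Set (State G)}
    (hB : ∀ u ∈ B, ∀ u' ∉ B, activityRate G ν u u' ≠ 0 → ∃ i, i ∈ u.1 ∧ u'.1 = u.1.erase i) :
    flow (activityRate G ν) π (Finset.univ.filter (· ∈ B)) ≤
      ∑ u, if u ∈ boundary ν B then u.1.card * π u else 0 := by
  rw [flow, Finset.sum_filter]
  refine Finset.sum_le_sum fun u _ => ?_
  by_cases hu : u ∈ B
  swap
  · rw [if_neg hu, if_neg (fun h => hu h.1)]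
  rw [if_pos hu, ← Finset.mul_sum, Finset.compl_filter]
  by_cases hb : u ∈ boundary ν B
  · rw [if_pos hb, mul_comm]
    refine mul_le_mul_of_nonneg_right ?_ (hπ0 u)
    have : ∀ u' ∈ Finset.univ.filter (fun x => x ∉ B), activityRate G ν u u' ≤
        ∑ i ∈ u.1, if u' = eraseState u i then 1 else 0 := by
      intro u' hu'
      have hnn : ∀ i ∈ u.1, (0 : ℝ) ≤ if u' = eraseState u i then 1 else 0 := fun i _ => by
        split_ifs <;> norm_num
      by_cases h0 : activityRate G ν u u' = 0
      · rw [h0]; exact Finset.sum_nonneg hnn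
      · obtain ⟨i, hi, he⟩ := hB u hu u' (Finset.mem_filter.1 hu').2 h0
        rw [activityRate_erase hi he]
        refine le_trans ?_ (Finset.single_le_sum hnn hi)
        rw [if_pos (Subtype.ext he)]
    refine (Finset.sum_le_sum this).trans ?_
    rw [Finset.sum_comm, Finset.card_eq_sum_ones]
    push_cast
    refine Finset.sum_le_sum fun i _ => ?_
    rw [Finset.sum_ite_eq']
    split_ifs <;> norm_num
  · rw [if_neg hb, Finset.sum_filter]
    refine mul_nonpos_of_nonneg_of_nonpos (hπ0 u) (not_lt.1 fun h => hb ⟨hu, ?_⟩)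
    convert h using 3

/-- One of the two masses is at least 1/2 and the other at least `a`; the two entries of the minimum
are the two cases. -/
theorem le_mul_of_bottleneck {p p' a ε d x : ℝ} (hp : p + p' = 1) (h1 : a ≤ p) (h2 : a ≤ p')
    (hε : 0 ≤ ε) (ha : 2 * ε ≤ a) (hd : d ≤ ε) (h : p * (p' - d) ≤ x) :
    min (a * (1 / 2 - ε)) ((a - ε) / 2) ≤ x := by
  have h3 : p * (p' - ε) ≤ x := by
    refine le_trans ?_ h
    have : 0 ≤ p := by linarith
    gcongr
  rcases le_total p (1 / 2) with hp2 | hp2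
  · refine (min_le_left _ _).trans (le_trans ?_ h3)
    have : 1 / 2 ≤ p' := by linarith
    exact mul_le_mul h1 (by linarith) (by linarith) (by linarith)
  · refine (min_le_right _ _).trans (le_trans ?_ h3)
    nlinarith

end HighLoad

end RandomAccess

end

/-! ### Assembly of the mixing time bound. -/

theorem theorem5 {V : Type*} [Fintype V] [Nonempty V] (G : SimpleGraph V)
    -- a `K`-partite interference graph in which every node is in a clique of size `K`
    {K : ℕ} (hK : 2 ≤ K) (c : G.Coloring (Fin K))
    (hclique : ∀ i : V, ∃ C : Finset V, i ∈ C ∧ G.IsNClique K C)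
    -- joint activity across components is relatively inefficient
    (hH : ∀ u : RandomAccess.State G, RandomAccess.H c u ≤ 1 ∧
      (u ∉ RandomAccess.fullStates c → RandomAccess.H c u < 1))
    -- traffic intensities `ρhat k` in component `k`, with total `ρ` and minimum `ρmin`
    (ρhat : Fin K → ℝ) (hρhat : ∀ k, 0 < ρhat k)
    (ρ ρmin : ℝ) (hρ : ρ = ∑ k, ρhat k) (hρmin : ρmin = ⨅ k, ρhat k)
    -- activation rates, equal within each component
    (ν : V → ℝ) (hν : ∀ i, 0 < ν i) (hνc : ∀ i j, c i = c j → ν i = ν j)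
    (hstable : RandomAccess.Stable G (fun i => ρhat (c i)) ν)
    (w : V → ℝ) (hw : ∀ i, 0 ≤ w i) (hw' : w ≠ 0)
    (γ : ℝ) (hγ : 0 < γ) (hγ' : γ < 1 / 4)
    (hload : 1 - γ * RandomAccess.zeta c * ρmin ^ 2 ≤ ρ)
    (π : RandomAccess.State G → ℝ)
    (hπ : RandomAccess.IsStationary (RandomAccess.activityRate G ν) π)
    (ε : ℝ) :
    ((((1 - γ) * ρmin - 2 * ε) *
        ((1 - 4 * γ) * ρmin ^ (RandomAccess.maxCompSize c + 2) / 2 ^ Fintype.card V) *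
        (1 / (1 - ρ)) ^ ((RandomAccess.maxCompSize c : ℝ) *
          (1 - RandomAccess.HstarMin c (fun i => ρhat (c i)) ν w)) : ℝ) : EReal) <
      RandomAccess.mixingTime (RandomAccess.activityRate G ν) π ε := by
  open RandomAccess in
  have : NeZero K := ⟨by omega⟩
  have hne : ∀ k, 0 < compSize c k := by
    obtain ⟨i⟩ := ‹Nonempty V›
    obtain ⟨C, -, hC⟩ := hclique i
    exact compSize_pos_of_isNClique hC c
  have hH1 : ∀ u : State G, H c u ≤ 1 := fun u => (hH u).1
  have hlam : ∀ i, 0 < ρhat (c i) := fun i => hρhat _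
  have hact := hstable.le_sum hlam hν hπ
  have hEH : ∑ u, π u * (1 - H c u) ≤ 1 - ρ :=
    sum_mul_one_sub_H_le hπ (hρ ▸ sum_le_sum_mul_H hne hact)
  have hr : 0 < 1 - ρ := pos_of_sum_mul_one_sub_H_le hν hπ hH1 hEH
  have hmin_le : ∀ k, ρmin ≤ ρhat k := fun k => by
    rw [hρmin]; exact ciInf_le (Set.finite_range _).bddBelow k
  have hmin_pos : 0 < ρmin := by
    obtain ⟨k, hk⟩ := exists_eq_ciInf_of_finite (f := ρhat)
    rw [hρmin, ← hk]; exact hρhat k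
  -- There are K ≥ 2 components and ρ < 1.
  have hmin_half : ρmin ≤ 1 / 2 := by
    have h1 : ∑ _k : Fin K, ρmin ≤ ∑ k, ρhat k := Finset.sum_le_sum fun k _ => hmin_le k
    rw [Finset.sum_const, Finset.card_univ, Fintype.card_fin, nsmul_eq_mul, ← hρ] at h1
    have h2 : (2 : ℝ) ≤ K := by exact_mod_cast hK
    nlinarith
  have hr1 : 1 - ρ ≤ 1 := by
    have : 0 ≤ ρ := by rw [hρ]; exact Finset.sum_nonneg fun k _ => (hρhat k).le
    linarith
  have hlam1 : ∀ i, ρhat (c i) ≤ 1 := fun i => by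
    have := Finset.single_le_sum (f := ρhat) (fun k _ => (hρhat k).le) (Finset.mem_univ (c i))
    rw [← hρ] at this; linarith
  have hζ := zeta_pos hne fun u => (hH u).2
  have hbad : (∑ u, if u ∉ fullStates c then π u else 0) ≤ γ * ρmin ^ 2 := by
    have h1 := sum_notMem_fullStates_le hπ.1 hH1
    refine le_of_mul_le_mul_right ?_ hζ
    calc _ ≤ 1 - ρ := h1.trans hEH
      _ ≤ _ := by linarith
  have hfull : ∀ k, ρmin - γ * ρmin ^ 2 ≤ π (fullState c k) := by
    intro k
    obtain ⟨i, hi⟩ := Finset.card_pos.1 (hne k)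
    have h1 := le_fullState_add (c := c) hπ.1 i
    have h2 := hact i
    rw [mem_component.1 hi] at h1 h2
    have h3 := hmin_le k
    linarith
  set a := (1 - γ) * ρmin with ha
  have ha0 : 0 < a := mul_pos (by linarith) hmin_pos
  have ha2 : a ≤ 1 / 2 := by nlinarith
  have hfull_a : ∀ k, a ≤ π (fullState c k) := fun k => by
    refine le_trans ?_ (hfull k)
    have : ρmin ^ 2 ≤ ρmin := by nlinarith
    rw [ha]
    nlinarith
  -- The constant 7/8 is 1 - (1/4)(1/2), from γ < 1/4 and ρ_min ≤ 1/2.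
  have hfull_b : ∀ k, 7 / 8 * ρmin ≤ π (fullState c k) := fun k => by
    refine le_trans ?_ (hfull k)
    have : γ * ρmin ≤ 1 / 4 * (1 / 2) := mul_le_mul hγ'.le hmin_half hmin_pos.le (by norm_num)
    nlinarith
  set M := maxCompSize c with hM
  set N := Fintype.card V with hN
  have hy : 0 < 7 / 8 * ρmin / (1 - ρ) := by positivity
  have hyν : ∀ i, 7 / 8 * ρmin / (1 - ρ) ≤ ν i := fun i => by
    rw [div_le_iff₀ hr, mul_comm (ν i)]
    exact (hfull_b (c i)).trans (fullState_le_mul_rate hν hνc hπ hH1 hne hEH i)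
  obtain ⟨k, T, l, hT, hT', hHmin⟩ :=
    exists_HstarMin_eq (c := c) (lam := fun i => ρhat (c i)) (ν := ν) hw hw'
  set hs := HstarMin c (fun i => ρhat (c i)) ν w with hhs
  set B := bottleneckSet c (fun i => ρhat (c i)) ν w k T l with hB
  set A := Finset.univ.filter (· ∈ B) with hA
  set R := (1 - ρ) ^ ((M : ℝ) * (1 - hs)) with hR
  have hRpos : 0 < R := Real.rpow_pos_of_pos hr _
  -- The factor 2^N is (7/4)^N (8/7)^N: the binomial sum at 3/4 times the loss from 7/8.
  set F := 2 ^ N * (ρmin ^ M)⁻¹ * R with hF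
  have hFpos : 0 < F := by positivity
  have hflow : flow (activityRate G ν) π A ≤ F := by
    refine (flow_le_sum_boundary hπ.1 fun u hu u' hu' h =>
      exists_erase_of_exit hν hw hH1 hne hu hu' h).trans ?_
    calc _ ≤ ∑ u : State G, (3 / 4) ^ u.1.card * ((8 / 7) ^ N * (ρmin ^ M)⁻¹ * R) := by
          refine Finset.sum_le_sum fun u _ => ?_
          split_ifs with hu
          · refine le_trans (mul_le_mul_of_nonneg_left
              (hπ.le_rpow hν hνc hH1 hy hyν u) (Nat.cast_nonneg _)) ?_
            exact card_mul_rpow_le hmin_pos hmin_half hr hr1 (H_nonneg u)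
              (hHmin ▸ H_le_Hl hu) (card_le_mul_H u) maxCompSize_le_card
          · positivity
      _ = (∑ u : State G, (3 / 4) ^ u.1.card) * ((8 / 7) ^ N * (ρmin ^ M)⁻¹ * R) := by
          rw [Finset.sum_mul]
      _ ≤ (3 / 4 + 1) ^ N * ((8 / 7) ^ N * (ρmin ^ M)⁻¹ * R) := by
          gcongr
          exact sum_pow_card_le G (by norm_num)
      _ = F := by
          rw [hF, ← mul_assoc, ← mul_assoc, ← mul_pow]
          norm_num
  obtain ⟨⟨k₁, hk₁⟩, ⟨k₂, hk₂⟩⟩ :=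
    exists_fullState_mem_notMem hK hν hw hlam hlam1 hH1 hT hT' l
  have hA1 : a ≤ ∑ x ∈ A, π x := (hfull_a k₁).trans
    (Finset.single_le_sum (f := π) (fun x _ => hπ.1 x) (by simp [hA, hB, hk₁]))
  have hA2 : a ≤ ∑ x ∈ Aᶜ, π x := (hfull_a k₂).trans
    (Finset.single_le_sum (f := π) (fun x _ => hπ.1 x) (by simp [hA, hB, hk₂]))
  have hsum1 : ∑ x ∈ A, π x + ∑ x ∈ Aᶜ, π x = 1 := by rw [Finset.sum_add_sum_compl, hπ.2.1]
  set X := (1 - 4 * γ) * ρmin ^ (M + 2) / 2 ^ N * (1 / (1 - ρ)) ^ ((M : ℝ) * (1 - hs)) with hX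
  have hX0 : 0 < X := by
    have : 0 < 1 - 4 * γ := by linarith
    positivity
  have hXF : X * F = (1 - 4 * γ) * ρmin ^ 2 := by
    rw [hX, hF, one_div, Real.inv_rpow hr.le, ← hR, pow_add]
    field_simp
  have hmix : ∀ b : ℝ, (a - 2 * ε) * X < b → (∀ t : ℝ, 0 ≤ t →
      maxDist (activityRate G ν) π t ≤ ε → b ≤ t) →
      (((a - 2 * ε) * X : ℝ) : EReal) < mixingTime (activityRate G ν) π ε := fun b h1 h2 =>
    lt_of_lt_of_le (EReal.coe_lt_coe_iff.2 h1)
      (le_iInf₂ fun t ht => EReal.coe_le_coe_iff.2 (h2 t ht.1 ht.2))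
  rw [mul_assoc]
  -- For ε < 0 no time qualifies, as d(t) ≥ 0, so any `b` is a lower bound. For 2ε > a the claimed
  -- bound is negative and t ≥ 0 suffices.
  rcases lt_or_ge ε 0 with hε | hε
  · have : Nonempty (State G) := ⟨emptyState G⟩
    exact hmix _ (lt_add_one _) fun t _ ht =>
      absurd ((maxDist_nonneg _ _ _).trans ht) (not_le.2 hε)
  rcases lt_or_ge (a - 2 * ε) 0 with haε | haε
  · exact hmix 0 (mul_neg_of_neg_of_pos haε hX0) fun t ht _ => ht
  set W := min (a * (1 / 2 - ε)) ((a - ε) / 2) with hW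
  have hW0 : 0 < W := lt_min (mul_pos ha0 (by linarith)) (by linarith)
  have hW2 : a - 2 * ε ≤ 2 * W := by
    rcases min_choice (a * (1 / 2 - ε)) ((a - ε) / 2) with h | h <;> rw [hW, h] <;> nlinarith
  refine hmix (W / F) ?_ fun t ht htd => ?_
  -- Strictness has room to spare: X · F ≤ 1/4 and a - 2ε ≤ 2W, so the left side is at most W/2.
  · rw [lt_div_iff₀ hFpos, mul_assoc, hXF]
    have h1 : (1 - 4 * γ) * ρmin ^ 2 ≤ 1 * (1 / 2) ^ 2 := by
      gcongr
      linarith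
    calc (a - 2 * ε) * ((1 - 4 * γ) * ρmin ^ 2) ≤ 2 * W * (1 * (1 / 2) ^ 2) :=
          mul_le_mul hW2 h1 (mul_nonneg (by linarith) (sq_nonneg _)) (by linarith)
      _ < W := by linarith
  · rw [div_le_iff₀ hFpos]
    refine (le_mul_of_bottleneck hsum1 hA1 hA2 hε (by linarith) htd
      (mul_sub_maxDist_le (activityRate_nonneg hν) hπ A ht)).trans ?_
    gcongr
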